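/- **Setting.** Let $\mathcal D_X$ be a known probability distribution on $\mathbb R$, and let $H=\{h_\tau:\tau\in T\}$ with $h_\tau(x)=1_{x\ge\tau}$ be a class of one-dimensional threshold functions, $\emptyset\ne T\subseteq\mathbb R$ (for instance $T=\mathbb R$). For a distribution $\mathcal D$ on $\mathbb R\times\{0,1\}$ put $\mathrm{err}(h)=\Pr_{(x,y)\sim\mathcal D}[h(x)\ne y]$. An active learner adaptively queries points $x$ and receives, for each query, an independent label $y\sim(Y\mid X=x)$. It solves $(\eta,\varepsilon,\delta)$ active agnostic learning with $m$ samples if, for every $\mathcal D$ with marginal $\mathcal D_X$ for which some $h\in H$ has $\mathrm{err}(h)\le\eta$, with probability at least $1-\delta$ it uses at most $m$ queries and outputs $\widehat h\in H$ with $\mathrm{err}(\widehat h)\le\eta+\varepsilon$. Write $\|h-g\|=\Pr_{x\sim\mathcal D_X}[h(x)\neq g(x)]$ and $\mathrm{lg}\,t=\max\{1,\log t\}$. **Algorithm 1** (noise level $\eta'>0$, accuracy $\varepsilon$, confidence $\delta$, constants $c_4,c_5,K_1,K_2$; $\alpha=1/5$, $R=c_4\eta'+c_5\varepsilon$). Let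 $H'\subseteq H$ be a maximal $2\eta'$-packing (maximal among the finite subsets of $H$ whose distinct members are at distance $>2\eta'$). Let $w(h)=1$ for $h\in H'$ and $S=C=\emptyset$. For a probability vector $\lambda$ on $H'$ and $S\subseteq H'$ the capped vector is $\overline\lambda_S(h)=\frac12\lambda(h)$ for $h\in S$ and $\overline\lambda_S(h)=\lambda(h)\frac{1-\frac12\lambda(S)}{1-\lambda(S)}$ for $h\in H'\setminus S$; balls are $B(\mu,r)=\{h\in H':\|h-\mu\|\le r\}$ with $\mu\in H'$. *Stage one.* Repeat $\lceil K_1\log(|H'|/\delta)\rceil$ times: (i) let $\lambda=w/\sum_{h\in H'}w(h)$; (ii) if some ball of radius $R$ has $\overline\lambda_S$-mass more than $80\%$, let $B(\mu',R)$ be a ball of radius $R$ of largest $\lambda$-mass, add $B(\mu',3R)$ to $S$ and $\mu'$ to $C$; (iii) with $\overline r(x)=\min\{\sum_h\overline\lambda_S(h)h(x),\,1-\sum_h\overline\lambda_S(h)h(x)\}$, let the probability distribution $q^*$ maximize $\mathbb E_{x\sim q}[\overline r(x)]-\frac{c_4}{20}\eta'\max_x\frac{q(x)}{\mathcal D_X(x)}$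 over $q$, where $\max_x\frac{q(x)}{\mathcal D_X(x)}$ is the least $M$ with $q\le M\mathcal D_X$; (iv) query $x\sim q^*$, getting $y$, and multiply $w(h)$ by $e^{-\alpha}$ for all $h\in H'$ with $h(x)\ne y$. *Stage two.* Let $\eta_2=3\eta'+3R$ and $t=\lceil K_2\log(|C|/\delta)\rceil$, with $C$ the set of centers found in stage one. As long as there are candidates $h,h'\in C$ with $\|h-h'\|\ge3\eta_2$, take such a pair, query $t$ independent points from $\mathcal D_X$ conditioned on $h(x)\ne h'(x)$, and remove from $C$ one of $h,h'$ that is wrong on at least half of them. Return any remaining candidate. Where several choices are possible (the packing, the heaviest ball, $q^*$, the pair, the removed candidate in a tie, the returned candidate) any fixed rule may be used, depending only on the current data of the algorithm: for the heaviest ball on $\lambda$, for $q^*$ on $\overline\lambda_S$, and for the pair, its order (in a tie its first member is removed) and the returned candidate on the current set of candidates. **Statement.** There are absolute constants $c_1>1$, $c_4\ge300$, $0<c_5\le\frac1{10}$ and $K_1,K_2,K>0$ such that for all $\mathcal D_X$ and $H$ as above and all $\eta\ge0$, $\varepsilon,\delta\in(0,1)$ with $\varepsilon>c_1\eta$ the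 following holds. Algorithm 1 with noise level $\eta'=\varepsilon/c_1$ is well defined (the required packing and maximizers exist), and, whatever rule is used for the open choices, it solves $(\eta,\varepsilon,\delta)$ active agnostic learning with at most $$K\,\mathrm{lg}\frac1{\varepsilon\delta}\cdot\mathrm{lg}\frac{\mathrm{lg}\frac1\varepsilon}{\delta}$$ samples, that is, with $O\!\left(\log\frac1{\varepsilon\delta}\,\log\frac{\log\frac1\varepsilon}{\delta}\right)$ samples. -/

import Mathlib

open MeasureTheory ProbabilityTheory
open scoped ENNReal

namespace ActiveLearning

noncomputable section

open scoped Classical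

/-! ### Active learners and what it means to solve an instance -/

/-- A randomized adaptive learner on the domain `X`, as an interaction tree.  Either it stops with
an output, or it draws a point `x` from the distribution `q`, asks for the label `y` of `x`, and
continues as `next x y`. -/
inductive Prog (X : Type) [MeasurableSpace X] (Out : Type) : Type
  | ret (o : Out) : Prog X Out
  | query (q : Measure X) (next : X → Bool → Prog X Out) : Prog X Out

/-- Sequential composition of learners. -/
def Prog.bind {X : Type} [MeasurableSpace X] {A B : Type} :
    Prog X A → (A → Prog X B) → Prog X B
  | .ret a, f => f a
  | .query q next, f => .query q fun x y => (next x y).bind f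

/-- The probability that the learner stops after at most `m` queries with an output in `good`,
where each query of a point `x` is answered by a fresh label drawn from `κ x`. -/
def Prog.successProb {X : Type} [MeasurableSpace X] {Out : Type} (κ : Kernel X Bool)
    (good : Set Out) : Prog X Out → ℕ → ℝ≥0∞
  | .ret o, _ => if o ∈ good then 1 else 0
  | .query _ _, 0 => 0
  | .query q next, m + 1 => ∫⁻ x, ∫⁻ y, (next x y).successProb κ good m ∂(κ x) ∂q

/-- A binary hypothesis (`true` is the label `1`). -/
abbrev Hyp (X : Type) : Type := X → Bool

/-- `err(h) = Pr_{(x,y) ∼ J}[h(x) ≠ y]`. -/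
def err {X : Type} [MeasurableSpace X] (J : Measure (X × Bool)) (h : Hyp X) : ℝ :=
  J.real {p | h p.1 ≠ p.2}

/-- The learner `A` solves the instance `(H, D, η, ε, δ)` with `m` queries.  For every joint law `J`
with marginal `D` (with `κ` a version of its conditional law of the label given the point) such
that some hypothesis in `H` has error at most `η`, with probability at least `1 - δ` the learner
uses at most `m` queries and outputs a member of `H` with error at most `η + ε`. -/
def Solves {X : Type} [MeasurableSpace X] (D : Measure X) (H : Set (Hyp X)) (η ε δ : ℝ) (m : ℕ)
    (A : Prog X (Hyp X)) : Prop :=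
  ∀ (J : Measure (X × Bool)) (κ : Kernel X Bool), IsProbabilityMeasure J → IsMarkovKernel κ →
    J.fst = D → J = D ⊗ₘ κ →
    (∃ h ∈ H, err J h ≤ η) →
    ENNReal.ofReal (1 - δ) ≤ A.successProb κ {h | h ∈ H ∧ err J h ≤ η + ε} m

/-! ### The ingredients of the algorithm -/

/-- `‖h - g‖ = Pr_{x ∼ D}[h(x) ≠ g(x)]`. -/
def hdist {X : Type} [MeasurableSpace X] (D : Measure X) (h g : Hyp X) : ℝ :=
  D.real {x | h x ≠ g x}

/-- A finite `r`-separated subset of `H`. -/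
def IsPacking {X : Type} [MeasurableSpace X] (D : Measure X) (H : Set (Hyp X)) (r : ℝ)
    (P : Finset (Hyp X)) : Prop :=
  (∀ h ∈ P, h ∈ H) ∧ ∀ h ∈ P, ∀ g ∈ P, h ≠ g → r < hdist D h g

/-- The ball of radius `r` around `μ`, within the finite class `P`. -/
def ball {X : Type} [MeasurableSpace X] (D : Measure X) (P : Finset (Hyp X)) (μ : Hyp X) (r : ℝ) :
    Finset (Hyp X) :=
  P.filter fun h => hdist D μ h ≤ r

/-- The mass of a finite set of hypotheses. -/
def mass {X : Type} (l : Hyp X → ℝ) (A : Finset (Hyp X)) : ℝ := ∑ h ∈ A, l h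

/-- The normalization `λ` of the weights `w` on `P`. -/
def normalize {X : Type} (P : Finset (Hyp X)) (w : Hyp X → ℝ) (h : Hyp X) : ℝ :=
  w h / mass w P

/-- The capped distribution `λ̄_S`. -/
def capped {X : Type} (l : Hyp X → ℝ) (S : Finset (Hyp X)) (h : Hyp X) : ℝ :=
  if h ∈ S then 1 / 2 * l h else l h * ((1 - 1 / 2 * mass l S) / (1 - mass l S))

/-- `r(x) = min { E_{h ∼ l}[h(x)], 1 - E_{h ∼ l}[h(x)] }`, for `l` on the finite class `P`. -/
def uncertainty {X : Type} (P : Finset (Hyp X)) (l : Hyp X → ℝ) (x : X) : ℝ :=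
  min (mass l (P.filter fun h => h x = true)) (1 - mass l (P.filter fun h => h x = true))

/-- `max_x q(x) / D(x)`: the least `M` with `q ≤ M D`, infinite if there is none. -/
def maxRatio {X : Type} [MeasurableSpace X] (q D : Measure X) : ℝ≥0∞ :=
  sInf {M : ℝ≥0∞ | q ≤ M • D}

/-- `E_{x ∼ q}[r(x)] - c max_x q(x) / D(x)`, for `q` with finite maximal ratio. -/
def objective {X : Type} [MeasurableSpace X] (D : Measure X) (r : X → ℝ) (c : ℝ)
    (q : Measure X) : ℝ :=
  ∫ x, r x ∂q - c * (maxRatio q D).toReal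

/-- `q` maximizes the objective over all probability measures.  Those with infinite maximal ratio
have objective `-∞` (for `c > 0`) and do not compete. -/
def IsOptimalQuery {X : Type} [MeasurableSpace X] (D : Measure X) (r : X → ℝ) (c : ℝ)
    (q : Measure X) : Prop :=
  IsProbabilityMeasure q ∧ maxRatio q D ≠ ⊤ ∧
    ∀ q' : Measure X, IsProbabilityMeasure q' → maxRatio q' D ≠ ⊤ →
      objective D r c q' ≤ objective D r c q

/-- Some ball of radius `R` centered in `P` has probability more than 80% under `l`. -/
def HasHeavyBall {X : Type} [MeasurableSpace X] (D : Measure X) (P : Finset (Hyp X))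
    (l : Hyp X → ℝ) (R : ℝ) : Prop :=
  ∃ μ ∈ P, 4 / 5 < mass l (ball D P μ R)

/-- `μ` is the center of a heaviest ball of radius `R` under `l`. -/
def IsHeaviestCenter {X : Type} [MeasurableSpace X] (D : Measure X) (P : Finset (Hyp X))
    (l : Hyp X → ℝ) (R : ℝ) (μ : Hyp X) : Prop :=
  μ ∈ P ∧ ∀ ν ∈ P, mass l (ball D P ν R) ≤ mass l (ball D P μ R)

/-- The radius `c₄ η + c₅ ε`. -/
def radius (c₄ c₅ η ε : ℝ) : ℝ := c₄ * η + c₅ * ε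

/-- The noise level `3 η + 3 (c₄ η + c₅ ε)` with which the second stage is run. -/
def noise₂ (c₄ c₅ η ε : ℝ) : ℝ := 3 * η + 3 * radius c₄ c₅ η ε

/-- The choices that the pseudo-code leaves open: which maximal packing, which heaviest ball, which
optimal query distribution, and, in the second stage, which pair of far candidates is compared next
and which surviving candidate is returned.  Any choices that meet these specifications are
allowed. -/
structure Choices {X : Type} [MeasurableSpace X] (D : Measure X) (H : Set (Hyp X))
    (c₄ c₅ η ε : ℝ) where
  /-- the maximal `2η`-packing `H'` of `H` -/
  pack : Finset (Hyp X)
  pack_spec : Maximal (IsPacking D H (2 * η)) pack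
  /-- the center of a heaviest ball, given the distribution `λ` -/
  center : (Hyp X → ℝ) → Hyp X
  center_spec : ∀ l, IsHeaviestCenter D pack l (radius c₄ c₅ η ε) (center l)
  /-- the query distribution `q*`, given the capped distribution `λ̄` -/
  queryDist : (Hyp X → ℝ) → Measure X
  queryDist_spec : ∀ l, IsOptimalQuery D (uncertainty pack l) (c₄ / 20 * η) (queryDist l)
  /-- a pair of candidates at distance at least three times the noise level, if there is one -/
  pair : Finset (Hyp X) → Hyp X × Hyp X
  pair_spec : ∀ F : Finset (Hyp X),
    (∃ h ∈ F, ∃ g ∈ F, 3 * noise₂ c₄ c₅ η ε ≤ hdist D h g) →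
      (pair F).1 ∈ F ∧ (pair F).2 ∈ F ∧
        3 * noise₂ c₄ c₅ η ε ≤ hdist D (pair F).1 (pair F).2
  /-- a remaining candidate -/
  out : Finset (Hyp X) → Hyp X
  out_spec : ∀ F : Finset (Hyp X), F.Nonempty → out F ∈ F

/-- The state of the first stage: weights, high-density region, centers found so far. -/
structure State (X : Type) where
  w : Hyp X → ℝ
  S : Finset (Hyp X)
  C : Finset (Hyp X)

/-- The learning rate. -/
def α : ℝ := 1 / 5

/-- The multiplicative update of the weights of `h ∈ P` on seeing the label `y` at `x`. -/
def reweight {X : Type} (P : Finset (Hyp X)) (w : Hyp X → ℝ) (x : X) (y : Bool) (h : Hyp X) : ℝ :=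
  if h ∈ P ∧ h x ≠ y then Real.exp (-α) * w h else w h

section Algorithm

variable {X : Type} [MeasurableSpace X] {D : Measure X} {H : Set (Hyp X)} {c₄ c₅ η ε : ℝ}

/-- The part of a round before the query: if the capped distribution has a heavy ball, the ball
of three times the radius around the center `μ'` of the heaviest ball is added to `S`, and `μ'` is
added to `C`. -/
def expand (ch : Choices D H c₄ c₅ η ε) (s : State X) : State X :=
  if HasHeavyBall D ch.pack (capped (normalize ch.pack s.w) s.S) (radius c₄ c₅ η ε) then
    { w := s.w
      S := s.S ∪ ball D ch.pack (ch.center (normalize ch.pack s.w)) (3 * radius c₄ c₅ η ε)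
      C := insert (ch.center (normalize ch.pack s.w)) s.C }
  else s

/-- The first stage, with a given number of rounds left. -/
def stage₁ (ch : Choices D H c₄ c₅ η ε) : ℕ → State X → Prog X (State X)
  | 0, s => .ret s
  | n + 1, s =>
    let s' := expand ch s
    .query (ch.queryDist (capped (normalize ch.pack s'.w) s'.S)) fun x y =>
      stage₁ ch n { w := reweight ch.pack s'.w x y, S := s'.S, C := s'.C }

/-- Query `n` independent points drawn from `q`, and return `e` plus the number of labels
that `h` gets wrong. -/
def countErrors (q : Measure X) (h : Hyp X) : ℕ → ℕ → Prog X ℕ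
  | 0, e => .ret e
  | n + 1, e => .query q fun x y => countErrors q h n (if h x ≠ y then e + 1 else e)

/-- The second stage, on the set `F` of remaining candidates: as long as there are two candidates
`h`, `h'` at distance at least three times the noise level, query `t` points drawn from `D`
conditioned on `h(x) ≠ h'(x)` and remove the one of the two that is wrong on at least half of them.
The first argument bounds the number of comparisons; the cardinality of the initial set is always
enough. -/
def stage₂ (ch : Choices D H c₄ c₅ η ε) (t : ℕ) : ℕ → Finset (Hyp X) → Prog X (Hyp X)
  | 0, F => .ret (ch.out F)
  | n + 1, F =>
    if ∃ h ∈ F, ∃ g ∈ F, 3 * noise₂ c₄ c₅ η ε ≤ hdist D h g then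
      (countErrors (cond D {x | (ch.pair F).1 x ≠ (ch.pair F).2 x}) (ch.pair F).1 t 0).bind
        fun e => stage₂ ch t n (F.erase (if t ≤ 2 * e then (ch.pair F).1 else (ch.pair F).2))
    else .ret (ch.out F)

/-- The competitive algorithm for active agnostic learning: `⌈K₁ log(|H'|/δ)⌉` rounds of
the first stage, then the second stage on the centers `C`, with `⌈K₂ log(|C|/δ)⌉` queries per
comparison. -/
def competitiveAlgorithm (ch : Choices D H c₄ c₅ η ε) (K₁ K₂ δ : ℝ) : Prog X (Hyp X) :=
  (stage₁ ch ⌈K₁ * Real.log (ch.pack.card / δ)⌉₊ { w := fun _ => 1, S := ∅, C := ∅ }).bind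
    fun s => stage₂ ch ⌈K₂ * Real.log (s.C.card / δ)⌉₊ s.C.card s.C

end Algorithm

/-! ### Threshold functions -/

/-- The hypotheses `h_τ(x) = 1_{x ≥ τ}` for `τ ∈ T`. -/
def thresholds (T : Set ℝ) : Set (Hyp ℝ) :=
  (fun τ : ℝ => fun x : ℝ => decide (τ ≤ x)) '' T

/-- The logarithm, read as `max {1, log t}` inside asymptotic bounds. -/
def lg (t : ℝ) : ℝ := max 1 (Real.log t)

end

end ActiveLearning

/-!
The first stage is a multiplicative-weights argument. Let `g` be a member of the packing `P` with
error `O(η)`. As long as `g` lies outside the high-density region `S`, the potential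
`√(w(P) w(P \ S)) / w(g)` is at least `1`, but every round shrinks it by a constant factor in
expectation: the uncertainty of the capped distribution under the query law is large, so much of the
weight is wrong on the label, whereas `g` is wrong with probability at most its error times the
maximal density ratio, which the query law was penalized for. Hence `S` soon contains `g`.

Uncertain queries exist because thresholds form a chain. When no ball of radius `R` is heavy, the
hypotheses that remain after discarding the lowest and the highest tenth of the mass do not fit into
one ball, so that the smallest and the largest of them differ on a set of mass more than `R`. Every
point of this set has uncertainty at least `1/10`, and conditioning `D` on it has density ratio less
than `1/R`.

In the second stage, a center close to `g` has error at most `1/3` on the set where it differs from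
a far candidate, so it loses a majority vote there with exponentially small probability, and every
candidate that is not far from it has small error.
-/

namespace ActiveLearning

noncomputable section

open scoped Classical

/-! ### Failure probabilities -/

section Prog

variable {X : Type} [MeasurableSpace X] {Out Out' : Type} {κ : Kernel X Bool} {good : Set Out}

/-- Under the labels `κ`, the learner `A` has probability at most `b` of not stopping within `m`
queries with an output in `good`.  Bounding the success probability from below keeps the notion
meaningful when success is not a measurable event. -/
def Prog.FailsAtMost (A : Prog X Out) (κ : Kernel X Bool) (good : Set Out) (m : ℕ) (b : ℝ) : Prop :=
  ENNReal.ofReal (1 - b) ≤ A.successProb κ good m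

theorem Prog.successProb_mono (A : Prog X Out) {m m' : ℕ} (h : m ≤ m') :
    A.successProb κ good m ≤ A.successProb κ good m' := by
  induction A generalizing m m' with
  | ret o => simp only [Prog.successProb, le_refl]
  | query q next ih =>
    cases m with
    | zero => simp only [Prog.successProb, zero_le]
    | succ m =>
      obtain ⟨m', rfl⟩ := Nat.exists_eq_add_of_lt h
      exact lintegral_mono fun x => lintegral_mono fun y => ih x y (by omega)

theorem Prog.successProb_mul_le_bind (A : Prog X Out) (f : Out → Prog X Out') {good' : Set Out'}
    {m' : ℕ} {p : ℝ≥0∞} (hp : p ≠ ⊤) (hf : ∀ o ∈ good, p ≤ (f o).successProb κ good' m') (m : ℕ) :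
    A.successProb κ good m * p ≤ (A.bind f).successProb κ good' (m + m') := by
  induction A generalizing m with
  | ret o =>
    by_cases ho : o ∈ good
    · simpa [Prog.successProb, Prog.bind, ho] using
        (hf o ho).trans (Prog.successProb_mono _ (Nat.le_add_left m' m))
    · simp [Prog.successProb, ho]
  | query q next ih =>
    cases m with
    | zero => simp [Prog.successProb]
    | succ m =>
      rw [Nat.add_right_comm, Prog.bind]
      simp only [Prog.successProb]
      simp_rw [← lintegral_mul_const' p _ hp]
      exact lintegral_mono fun x => lintegral_mono fun y => ih x y m

theorem Prog.FailsAtMost.mono {A : Prog X Out} {m m' : ℕ} {b b' : ℝ}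
    (h : A.FailsAtMost κ good m b) (hm : m ≤ m') (hb : b ≤ b') : A.FailsAtMost κ good m' b' :=
  (ENNReal.ofReal_le_ofReal (by linarith)).trans (h.trans (A.successProb_mono hm))

theorem Prog.FailsAtMost.of_one_le (A : Prog X Out) (m : ℕ) {b : ℝ} (hb : 1 ≤ b) :
    A.FailsAtMost κ good m b := by
  simp [Prog.FailsAtMost, ENNReal.ofReal_of_nonpos (sub_nonpos.2 hb)]

theorem Prog.FailsAtMost.ret {o : Out} (ho : o ∈ good) (m : ℕ) {b : ℝ} (hb : 0 ≤ b) :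
    (Prog.ret o : Prog X Out).FailsAtMost κ good m b := by
  simpa [Prog.FailsAtMost, Prog.successProb, ho] using hb

theorem Prog.FailsAtMost.bind {A : Prog X Out} {f : Out → Prog X Out'} {good' : Set Out'}
    {m m' : ℕ} {a b : ℝ} (hA : A.FailsAtMost κ good m a) (ha : 0 ≤ a) (hb : 0 ≤ b)
    (hf : ∀ o ∈ good, (f o).FailsAtMost κ good' m' b) :
    (A.bind f).FailsAtMost κ good' (m + m') (a + b) := by
  rcases le_total 1 a with ha1 | ha1
  · exact .of_one_le _ _ (by linarith)
  calc ENNReal.ofReal (1 - (a + b)) ≤ ENNReal.ofReal ((1 - a) * (1 - b)) :=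
        ENNReal.ofReal_le_ofReal (by nlinarith [mul_nonneg ha hb])
    _ = ENNReal.ofReal (1 - a) * ENNReal.ofReal (1 - b) := ENNReal.ofReal_mul (by linarith)
    _ ≤ A.successProb κ good m * ENNReal.ofReal (1 - b) := by gcongr; exact hA
    _ ≤ (A.bind f).successProb κ good' (m + m') :=
        A.successProb_mul_le_bind f ENNReal.ofReal_ne_top hf m

theorem ofReal_integral_le_lintegral_ofReal {Ω : Type*} [MeasurableSpace Ω] {μ : Measure Ω}
    {f : Ω → ℝ} (hf : Integrable f μ) :
    ENNReal.ofReal (∫ ω, f ω ∂μ) ≤ ∫⁻ ω, ENNReal.ofReal (f ω) ∂μ := by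
  rw [integral_eq_lintegral_pos_part_sub_lintegral_neg_part hf]
  exact (ENNReal.ofReal_le_ofReal (sub_le_self _ ENNReal.toReal_nonneg)).trans
    ENNReal.ofReal_toReal_le

theorem Prog.FailsAtMost.query [IsMarkovKernel κ] {q : Measure X} [IsProbabilityMeasure q]
    {next : X → Bool → Prog X Out} {m : ℕ} {b : X × Bool → ℝ} (hb : Measurable b)
    (hbi : Integrable b (q ⊗ₘ κ)) (h : ∀ x y, (next x y).FailsAtMost κ good m (b (x, y))) :
    (Prog.query q next).FailsAtMost κ good (m + 1) (∫ p, b p ∂(q ⊗ₘ κ)) :=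
  calc ENNReal.ofReal (1 - ∫ p, b p ∂(q ⊗ₘ κ)) = ENNReal.ofReal (∫ p, (1 - b p) ∂(q ⊗ₘ κ)) := by
        rw [integral_sub (integrable_const 1) hbi, integral_const, probReal_univ, one_smul]
    _ ≤ ∫⁻ p, ENNReal.ofReal (1 - b p) ∂(q ⊗ₘ κ) :=
        ofReal_integral_le_lintegral_ofReal ((integrable_const 1).sub hbi)
    _ = ∫⁻ x, ∫⁻ y, ENNReal.ofReal (1 - b (x, y)) ∂(κ x) ∂q :=
        Measure.lintegral_compProd (measurable_const.sub hb).ennreal_ofReal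
    _ ≤ (Prog.query q next).successProb κ good (m + 1) :=
        lintegral_mono fun x => lintegral_mono fun y => h x y

theorem Prog.FailsAtMost.query_mul [IsMarkovKernel κ] {q : Measure X} [IsProbabilityMeasure q]
    {next : X → Bool → Prog X Out} {m : ℕ} {Φ ρ : ℝ} {u : X × Bool → ℝ} (hΦ : 0 ≤ Φ)
    (hu : Measurable u) (hui : Integrable u (q ⊗ₘ κ)) (hρ : ∫ p, u p ∂(q ⊗ₘ κ) ≤ ρ)
    (h : ∀ x y, (next x y).FailsAtMost κ good m (Φ * u (x, y))) :
    (Prog.query q next).FailsAtMost κ good (m + 1) (Φ * ρ) := by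
  refine (Prog.FailsAtMost.query (hu.const_mul Φ) (hui.const_mul Φ) h).mono le_rfl ?_
  rw [integral_const_mul]
  gcongr

end Prog

/-! ### Errors and distances -/

section Distance

variable {X : Type} [MeasurableSpace X] {D : Measure X}

theorem hdist_comm (h g : Hyp X) : hdist D h g = hdist D g h := by
  simp only [hdist, ne_comm]

theorem hdist_self (h : Hyp X) : hdist D h h = 0 := by simp [hdist]

theorem hdist_triangle [IsFiniteMeasure D] (f g h : Hyp X) :
    hdist D f h ≤ hdist D f g + hdist D g h :=
  have hsub : {x | f x ≠ h x} ⊆ {x | f x ≠ g x} ∪ {x | g x ≠ h x} :=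
    fun x hx => (Ne.ne_or_ne (g x) hx).imp_right Ne.symm
  (measureReal_mono hsub).trans (measureReal_union_le _ _)

theorem measurableSet_hyp_ne {h g : Hyp X} (hh : Measurable h) (hg : Measurable g) :
    MeasurableSet {x | h x ≠ g x} :=
  (measurableSet_eq_fun hh hg).compl

theorem measurableSet_wrong {h : Hyp X} (hh : Measurable h) :
    MeasurableSet {p : X × Bool | h p.1 ≠ p.2} :=
  (measurableSet_eq_fun (hh.comp measurable_fst) measurable_snd).compl

theorem hdist_eq_measureReal_preimage {J : Measure (X × Bool)} (hJ : J.fst = D) {h g : Hyp X}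
    (hh : Measurable h) (hg : Measurable g) :
    hdist D h g = J.real (Prod.fst ⁻¹' {x | h x ≠ g x}) := by
  rw [hdist, ← hJ, measureReal_def, Measure.fst_apply (measurableSet_hyp_ne hh hg), measureReal_def]

theorem hdist_le_err_add_err {J : Measure (X × Bool)} [IsFiniteMeasure J] (hJ : J.fst = D)
    {h g : Hyp X} (hh : Measurable h) (hg : Measurable g) : hdist D h g ≤ err J h + err J g := by
  have hsub : Prod.fst ⁻¹' {x | h x ≠ g x} ⊆ {p : X × Bool | h p.1 ≠ p.2} ∪ {p | g p.1 ≠ p.2} :=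
    fun p hp => Ne.ne_or_ne p.2 hp
  rw [hdist_eq_measureReal_preimage hJ hh hg]
  exact (measureReal_mono hsub).trans (measureReal_union_le _ _)

theorem err_le_err_add_hdist {J : Measure (X × Bool)} [IsFiniteMeasure J] (hJ : J.fst = D)
    {h g : Hyp X} (hh : Measurable h) (hg : Measurable g) :
    err J h ≤ err J g + hdist D h g := by
  have hsub : {p : X × Bool | h p.1 ≠ p.2} ⊆
      {p | g p.1 ≠ p.2} ∪ Prod.fst ⁻¹' {x | h x ≠ g x} :=
    fun p hp => (Ne.ne_or_ne (g p.1) hp).symm.imp_left Ne.symm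
  rw [hdist_eq_measureReal_preimage hJ hh hg]
  exact (measureReal_mono hsub).trans (measureReal_union_le _ _)

theorem err_compProd_le {κ : Kernel X Bool} [IsMarkovKernel κ] [IsFiniteMeasure D]
    {q : Measure X} [SFinite q] {M : ℝ≥0∞} (hM : M ≠ ⊤) (hq : q ≤ M • D) {h : Hyp X}
    (hh : Measurable h) : err (q ⊗ₘ κ) h ≤ M.toReal * err (D ⊗ₘ κ) h := by
  have hle : (q ⊗ₘ κ) {p | h p.1 ≠ p.2} ≤ M * (D ⊗ₘ κ) {p | h p.1 ≠ p.2} := by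
    rw [Measure.compProd_apply (measurableSet_wrong hh),
      Measure.compProd_apply (measurableSet_wrong hh), ← smul_eq_mul, ← lintegral_smul_measure]
    exact lintegral_mono' hq le_rfl
  rw [err, err, measureReal_def, measureReal_def, ← ENNReal.toReal_mul]
  exact ENNReal.toReal_mono (ENNReal.mul_ne_top hM (measure_ne_top _ _)) hle

end Distance

/-! ### The maximal ratio -/

section MaxRatio

variable {X : Type} [MeasurableSpace X] {D : Measure X}

theorem maxRatio_le {q : Measure X} {M : ℝ≥0∞} (h : q ≤ M • D) : maxRatio q D ≤ M := sInf_le h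

theorem le_maxRatio_smul [IsFiniteMeasure D] {q : Measure X} (h : maxRatio q D ≠ ⊤) :
    q ≤ maxRatio q D • D := by
  obtain ⟨M₀, hM₀, -⟩ := sInf_lt_iff.1 (lt_top_iff_ne_top.2 h)
  refine Measure.le_iff.2 fun s _ => ?_
  simp only [Measure.smul_apply, smul_eq_mul]
  by_cases hs : D s = 0
  · simpa [hs] using hM₀ s
  · rw [← ENNReal.div_le_iff hs (measure_ne_top D s)]
    refine le_sInf fun M hM => ?_
    rw [ENNReal.div_le_iff hs (measure_ne_top D s)]
    exact hM s

theorem measureReal_le_maxRatio_mul [IsFiniteMeasure D] {q : Measure X} (hq : maxRatio q D ≠ ⊤)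
    (s : Set X) : q.real s ≤ (maxRatio q D).toReal * D.real s := by
  rw [measureReal_def, measureReal_def, ← ENNReal.toReal_mul]
  exact ENNReal.toReal_mono (ENNReal.mul_ne_top hq (measure_ne_top D s)) (le_maxRatio_smul hq s)

theorem cond_le_smul (A : Set X) : ProbabilityTheory.cond D A ≤ (D A)⁻¹ • D :=
  Measure.le_iff.2 fun s _ => by
    simp only [ProbabilityTheory.cond, Measure.smul_apply, smul_eq_mul]
    gcongr
    exact Measure.restrict_le_self

end MaxRatio

/-! ### Existence of an optimal query distribution -/

section OptimalQuery

variable {X : Type} [MeasurableSpace X] {D : Measure X} {ι : Type*} {π : X → ι} {p : ι → ℝ}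

/-- The measure with density constant on the cells of the partition `π`, of mass `p i` on the cell
`i`, with respect to `D`.  Cells that are null for `D` get mass `0`. -/
def cellMeasure (D : Measure X) (π : X → ι) (p : ι → ℝ) : Measure X :=
  D.withDensity fun x => ENNReal.ofReal (p (π x) / D.real (π ⁻¹' {π x}))

/-- The cell masses of the probability measures absolutely continuous with respect to `D`. -/
def cellMasses (D : Measure X) (π : X → ι) [Fintype ι] : Set (ι → ℝ) :=
  stdSimplex ℝ ι ∩ {p | ∀ i, D.real (π ⁻¹' {i}) = 0 → p i = 0}

/-- The objective of `cellMeasure D π p`, for a reward that takes the value `G i` on the cell `i`: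
the sup norm is the largest value of the density. -/
def cellObjective (D : Measure X) (π : X → ι) [Fintype ι] (G : ι → ℝ) (c : ℝ) (p : ι → ℝ) : ℝ :=
  ∑ i, G i * p i - c * ‖fun i => p i / D.real (π ⁻¹' {i})‖

variable [Fintype ι]

theorem isCompact_cellMasses : IsCompact (cellMasses D π) := by
  refine (isCompact_stdSimplex ℝ ι).inter_right ?_
  simp only [Set.ofPred_forall]
  exact isClosed_iInter fun i => isClosed_iInter fun _ =>
    isClosed_eq (continuous_apply i) continuous_const

theorem continuous_cellObjective (G : ι → ℝ) (c : ℝ) : Continuous (cellObjective D π G c) := by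
  unfold cellObjective
  fun_prop

theorem cellMeasure_le_smul :
    cellMeasure D π p ≤ ENNReal.ofReal ‖fun i => p i / D.real (π ⁻¹' {i})‖ • D := by
  rw [cellMeasure, ← withDensity_const]
  refine withDensity_mono (ae_of_all _ fun x => ENNReal.ofReal_le_ofReal ?_)
  exact (Real.le_norm_self _).trans (norm_le_pi_norm (fun i => p i / D.real (π ⁻¹' {i})) (π x))

variable [MeasurableSpace ι] [MeasurableSingletonClass ι]

theorem integral_comp_eq_sum (hπ : Measurable π) (G : ι → ℝ) (q : Measure X) [IsFiniteMeasure q] :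
    ∫ x, G (π x) ∂q = ∑ i, G i * q.real (π ⁻¹' {i}) := by
  rw [← integral_map (f := G) hπ.aemeasurable (measurable_of_finite G).aestronglyMeasurable,
    integral_fintype Integrable.of_finite]
  refine Finset.sum_congr rfl fun i _ => ?_
  rw [smul_eq_mul, mul_comm, map_measureReal_apply hπ (measurableSet_singleton i)]

theorem cellMeasure_preimage_singleton [IsFiniteMeasure D] (hπ : Measurable π)
    (hp : p ∈ cellMasses D π) (i : ι) :
    cellMeasure D π p (π ⁻¹' {i}) = ENNReal.ofReal (p i) := by
  have hi : MeasurableSet (π ⁻¹' {i}) := hπ (measurableSet_singleton i)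
  have density_eq : Set.EqOn (fun x => ENNReal.ofReal (p (π x) / D.real (π ⁻¹' {π x})))
      (fun _ => ENNReal.ofReal (p i / D.real (π ⁻¹' {i}))) (π ⁻¹' {i}) := by
    rintro x rfl
    rfl
  rw [cellMeasure, withDensity_apply _ hi, setLIntegral_congr_fun hi density_eq,
    setLIntegral_const, ← ofReal_measureReal,
    ← ENNReal.ofReal_mul (div_nonneg (hp.1.1 i) measureReal_nonneg), div_mul_cancel_of_imp (hp.2 i)]

theorem isProbabilityMeasure_cellMeasure [IsFiniteMeasure D] (hπ : Measurable π)
    (hp : p ∈ cellMasses D π) : IsProbabilityMeasure (cellMeasure D π p) where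
  measure_univ := by
    rw [← Set.preimage_univ (f := π), ← Finset.coe_univ, ← sum_measure_preimage_singleton _
      fun i _ => hπ (measurableSet_singleton i)]
    simp only [cellMeasure_preimage_singleton hπ hp]
    rw [← ENNReal.ofReal_sum_of_nonneg fun i _ => hp.1.1 i, hp.1.2, ENNReal.ofReal_one]

theorem cellObjective_le_objective [IsFiniteMeasure D] (hπ : Measurable π)
    (hp : p ∈ cellMasses D π) (G : ι → ℝ) {c : ℝ} (hc : 0 ≤ c) :
    cellObjective D π G c p ≤ objective D (fun x => G (π x)) c (cellMeasure D π p) := by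
  have := isProbabilityMeasure_cellMeasure hπ hp
  have cell_mass : ∀ i, (cellMeasure D π p).real (π ⁻¹' {i}) = p i := fun i => by
    rw [measureReal_def, cellMeasure_preimage_singleton hπ hp, ENNReal.toReal_ofReal (hp.1.1 i)]
  have ratio_le := ENNReal.toReal_le_of_le_ofReal (norm_nonneg _)
    (maxRatio_le (cellMeasure_le_smul (D := D) (π := π) (p := p)))
  simp only [cellObjective, objective, integral_comp_eq_sum hπ, cell_mass]
  gcongr

theorem cell_masses_mem [IsFiniteMeasure D] (hπ : Measurable π) {q : Measure X}
    [IsProbabilityMeasure q] (hq : maxRatio q D ≠ ⊤) :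
    (fun i => q.real (π ⁻¹' {i})) ∈ cellMasses D π := by
  refine ⟨⟨fun i => measureReal_nonneg, ?_⟩, fun i hi => ?_⟩
  · simpa using (integral_comp_eq_sum hπ (fun _ => (1 : ℝ)) q).symm
  · have hle := measureReal_le_maxRatio_mul hq (π ⁻¹' {i})
    rw [hi, mul_zero] at hle
    exact le_antisymm hle measureReal_nonneg

theorem objective_le_cellObjective [IsFiniteMeasure D] (hπ : Measurable π) (G : ι → ℝ) {c : ℝ}
    (hc : 0 ≤ c) {q : Measure X} [IsProbabilityMeasure q] (hq : maxRatio q D ≠ ⊤) :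
    objective D (fun x => G (π x)) c q ≤ cellObjective D π G c fun i => q.real (π ⁻¹' {i}) := by
  rw [objective, cellObjective, integral_comp_eq_sum hπ]
  gcongr
  refine (pi_norm_le_iff_of_nonneg ENNReal.toReal_nonneg).2 fun i => ?_
  rw [Real.norm_of_nonneg (div_nonneg measureReal_nonneg measureReal_nonneg)]
  exact div_le_of_le_mul₀ measureReal_nonneg ENNReal.toReal_nonneg
    (measureReal_le_maxRatio_mul hq _)

end OptimalQuery

/-- Averaging a density over the level sets of `r` does not decrease the objective, and what remains
is the maximum of a continuous function on a compact set. -/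
theorem exists_isOptimalQuery {X : Type} [MeasurableSpace X] {D : Measure X}
    [IsProbabilityMeasure D] {r : X → ℝ} (hr : Measurable r) (hfin : (Set.range r).Finite) {c : ℝ}
    (hc : 0 ≤ c) : ∃ q, IsOptimalQuery D r c q := by
  have := hfin.fintype
  have hπ : Measurable (Set.rangeFactorization r) := hr.subtype_mk
  have hD : maxRatio D D ≠ ⊤ := ne_top_of_le_ne_top ENNReal.one_ne_top (maxRatio_le (by simp))
  obtain ⟨p, hp, hmax⟩ := isCompact_cellMasses.exists_isMaxOn ⟨_, cell_masses_mem hπ hD⟩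
    (continuous_cellObjective (D := D) (π := Set.rangeFactorization r) Subtype.val c).continuousOn
  refine ⟨cellMeasure D (Set.rangeFactorization r) p, isProbabilityMeasure_cellMeasure hπ hp,
    ne_top_of_le_ne_top ENNReal.ofReal_ne_top (maxRatio_le cellMeasure_le_smul), fun q _ hq => ?_⟩
  calc objective D r c q ≤ _ := objective_le_cellObjective hπ Subtype.val hc hq
    _ ≤ cellObjective D (Set.rangeFactorization r) Subtype.val c p := hmax (cell_masses_mem hπ hq)
    _ ≤ objective D r c _ := cellObjective_le_objective hπ hp Subtype.val hc

/-! ### Probability vectors and their uncertainty -/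

section Mass

variable {X : Type} {l w : Hyp X → ℝ} {A B P S Q : Finset (Hyp X)}

theorem mass_mono (hAB : A ⊆ B) (hl : ∀ h ∈ B, 0 ≤ l h) : mass l A ≤ mass l B :=
  Finset.sum_le_sum_of_subset_of_nonneg hAB fun h hB _ => hl h hB

theorem mass_nonneg (hl : ∀ h ∈ A, 0 ≤ l h) : 0 ≤ mass l A := Finset.sum_nonneg hl

theorem mass_pos (hA : A.Nonempty) (hl : ∀ h ∈ A, 0 < l h) : 0 < mass l A := Finset.sum_pos hl hA

theorem mass_filter_add_mass_filter_not (l : Hyp X → ℝ) (A : Finset (Hyp X)) (p : Hyp X → Prop)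
    [DecidablePred p] [DecidablePred fun h => ¬ p h] :
    mass l (A.filter p) + mass l (A.filter fun h => ¬ p h) = mass l A :=
  Finset.sum_filter_add_sum_filter_not A p l

theorem mass_sdiff_add (l : Hyp X → ℝ) (h : A ⊆ B) : mass l (B \ A) + mass l A = mass l B :=
  Finset.sum_sdiff h

theorem mass_union_le (hB : ∀ h ∈ A ∪ B, 0 ≤ l h) : mass l (A ∪ B) ≤ mass l A + mass l B := by
  have hinter : mass l (A ∪ B) + mass l (A ∩ B) = mass l A + mass l B := Finset.sum_union_inter
  have : 0 ≤ mass l (A ∩ B) := mass_nonneg fun h hh => hB h (Finset.inter_subset_union hh)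
  linarith

/-- A probability vector on `P`.  Its values outside `P` are arbitrary, as for the distributions
`λ` and `λ̄` of the algorithm. -/
structure IsProbVector (P : Finset (Hyp X)) (l : Hyp X → ℝ) : Prop where
  nonneg : ∀ h ∈ P, 0 ≤ l h
  mass_eq_one : mass l P = 1

theorem IsProbVector.mass_le_one (hl : IsProbVector P l) (hA : A ⊆ P) : mass l A ≤ 1 :=
  (mass_mono hA hl.nonneg).trans_eq hl.mass_eq_one

theorem IsProbVector.mass_mono (hl : IsProbVector P l) (hB : B ⊆ P) (hAB : A ⊆ B) :
    mass l A ≤ mass l B :=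
  ActiveLearning.mass_mono hAB fun h hh => hl.nonneg h (hB hh)

theorem IsProbVector.uncertainty_nonneg (hl : IsProbVector P l) (x : X) : 0 ≤ uncertainty P l x :=
  le_min (mass_nonneg fun h hh => hl.nonneg h (Finset.mem_filter.1 hh).1)
    (sub_nonneg.2 (hl.mass_le_one (Finset.filter_subset _ _)))

theorem IsProbVector.uncertainty_le_one (hl : IsProbVector P l) (x : X) : uncertainty P l x ≤ 1 :=
  (min_le_left _ _).trans (hl.mass_le_one (Finset.filter_subset _ _))

theorem IsProbVector.uncertainty_le_mass_wrong (hl : IsProbVector P l) (x : X) (y : Bool) :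
    uncertainty P l x ≤ mass l (P.filter fun h => h x ≠ y) := by
  have hsplit := mass_filter_add_mass_filter_not l P fun h => h x = true
  rw [hl.mass_eq_one] at hsplit
  cases y with
  | true => exact (min_le_right _ _).trans_eq (by linarith)
  | false => exact (min_le_left _ _).trans_eq (by simp only [ne_eq, Bool.not_eq_false])

theorem measurable_uncertainty [MeasurableSpace X] (hP : ∀ h ∈ P, Measurable h) (l : Hyp X → ℝ) :
    Measurable (uncertainty P l) := by
  have mass_measurable : Measurable fun x => mass l (P.filter fun h => h x = true) := by
    simp only [mass, Finset.sum_filter]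
    refine Finset.measurable_sum _ fun h hh => Measurable.ite ?_ measurable_const measurable_const
    exact hP h hh (measurableSet_singleton true)
  exact mass_measurable.min (measurable_const.sub mass_measurable)

theorem finite_range_uncertainty (P : Finset (Hyp X)) (l : Hyp X → ℝ) :
    (Set.range (uncertainty P l)).Finite := by
  refine (P.powerset.image fun A => min (mass l A) (1 - mass l A)).finite_toSet.subset ?_
  rintro _ ⟨x, rfl⟩
  exact Finset.mem_image_of_mem _ (Finset.mem_powerset.2 (Finset.filter_subset _ _))

theorem IsProbVector.integrable_uncertainty [MeasurableSpace X] (hl : IsProbVector P l)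
    (hP : ∀ h ∈ P, Measurable h) (q : Measure X) [IsFiniteMeasure q] :
    Integrable (uncertainty P l) q :=
  .of_bound (measurable_uncertainty hP l).aestronglyMeasurable 1 <| ae_of_all _ fun x => by
    rw [Real.norm_of_nonneg (hl.uncertainty_nonneg x)]
    exact hl.uncertainty_le_one x

theorem mass_normalize (P : Finset (Hyp X)) (w : Hyp X → ℝ) (Q : Finset (Hyp X)) :
    mass (normalize P w) Q = mass w Q / mass w P := by
  simp only [mass, normalize, Finset.sum_div]

theorem isProbVector_normalize (hP : P.Nonempty) (hw : ∀ h ∈ P, 0 < w h) :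
    IsProbVector P (normalize P w) where
  nonneg h hh := div_nonneg (hw h hh).le (mass_pos hP hw).le
  mass_eq_one := by rw [mass_normalize, div_self (mass_pos hP hw).ne']

theorem mass_normalize_lt_one (hw : ∀ h ∈ P, 0 < w h) (hSP : S ⊆ P) (hne : (P \ S).Nonempty) :
    mass (normalize P w) S < 1 := by
  have hpos : 0 < mass w (P \ S) := mass_pos hne fun h hh => hw h (Finset.mem_sdiff.1 hh).1
  rw [mass_normalize, div_lt_one (mass_pos (hne.mono Finset.sdiff_subset) hw),
    ← mass_sdiff_add w hSP]
  linarith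

/-! ### The capped distribution -/

theorem mass_capped (hS : mass l S < 1) (Q : Finset (Hyp X)) :
    mass (capped l S) Q = 1 / 2 * mass l Q + 1 / 2 * (mass l (Q \ S) / (1 - mass l S)) := by
  have hne : 1 - mass l S ≠ 0 := by linarith
  have mass_sdiff : mass l (Q \ S) = ∑ h ∈ Q, if h ∈ S then 0 else l h := by
    simp only [mass, Finset.sdiff_eq_filter, Finset.sum_filter, ite_not]
  rw [mass_sdiff, Finset.sum_div, Finset.mul_sum, mass, mass, Finset.mul_sum,
    ← Finset.sum_add_distrib]
  refine Finset.sum_congr rfl fun h _ => ?_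
  rw [capped]
  split_ifs
  · ring
  · field_simp
    ring

theorem IsProbVector.mass_sdiff_div_le_one (hl : IsProbVector P l) (hSP : S ⊆ P)
    (hS : mass l S < 1) (hQP : Q ⊆ P) : mass l (Q \ S) / (1 - mass l S) ≤ 1 := by
  have hP := mass_sdiff_add l hSP
  have hQ := hl.mass_mono Finset.sdiff_subset (Finset.sdiff_subset_sdiff hQP (le_refl S))
  rw [div_le_one (by linarith)]
  linarith [hl.mass_eq_one]

theorem IsProbVector.capped (hl : IsProbVector P l) (hSP : S ⊆ P) (hS : mass l S < 1) :
    IsProbVector P (capped l S) where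
  nonneg h hh := by
    have := hl.nonneg h hh
    rw [ActiveLearning.capped]
    split_ifs
    · positivity
    · exact mul_nonneg this (div_nonneg (by linarith) (by linarith))
  mass_eq_one := by
    have hP := mass_sdiff_add l hSP
    rw [hl.mass_eq_one] at hP
    rw [mass_capped hS, hl.mass_eq_one, eq_sub_of_add_eq hP, div_self (by linarith)]
    norm_num

theorem ball_subset [MeasurableSpace X] {D : Measure X} (P : Finset (Hyp X)) (μ : Hyp X) (r : ℝ) :
    ball D P μ r ⊆ P :=
  Finset.filter_subset _ _

theorem ball_subset_ball_of_not_disjoint [MeasurableSpace X] {D : Measure X} [IsFiniteMeasure D]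
    {μ ν : Hyp X} {R : ℝ} (h : ¬ Disjoint (ball D P ν R) (ball D P μ R)) :
    ball D P ν R ⊆ ball D P μ (3 * R) := by
  obtain ⟨g, hgν, hgμ⟩ := Finset.not_disjoint_iff.1 h
  simp only [ball, Finset.mem_filter] at hgν hgμ
  intro f hf
  simp only [ball, Finset.mem_filter] at hf ⊢
  refine ⟨hf.1, ?_⟩
  have := hdist_triangle (D := D) μ g f
  have := hdist_triangle (D := D) g ν f
  linarith [hdist_comm (D := D) g ν]

theorem IsHeaviestCenter.three_fifths_lt [MeasurableSpace X] {D : Measure X}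
    (hl : IsProbVector P l) (hSP : S ⊆ P) (hS : mass l S < 1) {R : ℝ} {μ : Hyp X}
    (hμ : IsHeaviestCenter D P l R μ) (hheavy : HasHeavyBall D P (capped l S) R) :
    3 / 5 < mass l (ball D P μ R) := by
  obtain ⟨ν, hν, hmass⟩ := hheavy
  rw [mass_capped hS] at hmass
  linarith [hl.mass_sdiff_div_le_one hSP hS (ball_subset (D := D) P ν R), hμ.2 ν hν]

/-- A ball that is heavy after capping has `l`-mass more than `3/5`, hence meets the heaviest ball
and lies in its threefold enlargement; there capping leaves at most half of the mass. -/
theorem not_hasHeavyBall_capped_union [MeasurableSpace X] {D : Measure X} [IsFiniteMeasure D]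
    (hl : IsProbVector P l) (hSP : S ⊆ P) {R : ℝ} {μ : Hyp X} (hμ : IsHeaviestCenter D P l R μ)
    (hS' : mass l (S ∪ ball D P μ (3 * R)) < 1) (hheavy : HasHeavyBall D P (capped l S) R) :
    ¬ HasHeavyBall D P (capped l (S ∪ ball D P μ (3 * R))) R := by
  have hS'P : S ∪ ball D P μ (3 * R) ⊆ P := Finset.union_subset hSP (ball_subset _ _ _)
  have hS : mass l S < 1 := (hl.mass_mono hS'P Finset.subset_union_left).trans_lt hS'
  have hμmass := hμ.three_fifths_lt hl hSP hS hheavy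
  rintro ⟨ν, -, hmass⟩
  rw [mass_capped hS'] at hmass
  by_cases hdisj : Disjoint (ball D P ν R) (ball D P μ R)
  · have hsum : mass l (ball D P ν R) + mass l (ball D P μ R) ≤ 1 := by
      rw [mass, mass, ← Finset.sum_union hdisj]
      exact hl.mass_le_one (Finset.union_subset (ball_subset _ _ _) (ball_subset _ _ _))
    linarith [hl.mass_sdiff_div_le_one hS'P hS' (ball_subset (D := D) P ν R)]
  · have hsub : ball D P ν R ⊆ S ∪ ball D P μ (3 * R) :=
      (ball_subset_ball_of_not_disjoint hdisj).trans Finset.subset_union_right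
    rw [Finset.sdiff_eq_empty_iff_subset.2 hsub, mass, mass, Finset.sum_empty, zero_div] at hmass
    linarith [show ∑ h ∈ ball D P ν R, l h ≤ 1 from hl.mass_le_one (ball_subset _ _ _)]

end Mass

/-! ### Packings -/

section Packing

variable {X : Type} [MeasurableSpace X] {D : Measure X} {H : Set (Hyp X)} {P : Finset (Hyp X)}
  {r : ℝ} {h g : Hyp X}

theorem IsPacking.insert (hP : IsPacking D H r P) (hh : h ∈ H) (hfar : ∀ g ∈ P, r < hdist D g h) :
    IsPacking D H r (insert h P) := by
  refine ⟨Finset.forall_mem_insert _ _ _ |>.2 ⟨hh, hP.1⟩, fun f hf g hg hne => ?_⟩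
  rcases Finset.mem_insert.1 hf with rfl | hfP <;>
    rcases Finset.mem_insert.1 hg with rfl | hgP
  · exact absurd rfl hne
  · exact hdist_comm (D := D) g f ▸ hfar g hgP
  · exact hfar f hfP
  · exact hP.2 f hfP g hgP hne

theorem exists_hdist_le_of_maximal (hr : 0 ≤ r) (hP : Maximal (IsPacking D H r) P) (hh : h ∈ H) :
    ∃ g ∈ P, hdist D g h ≤ r := by
  by_contra! hfar
  have hmem : h ∈ P := hP.2 (hP.1.insert hh hfar) (Finset.subset_insert h P)
    (Finset.mem_insert_self h P)
  exact (hfar h hmem).not_ge (hdist_self (D := D) h ▸ hr)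

theorem nonempty_of_maximal (hr : 0 ≤ r) (hP : Maximal (IsPacking D H r) P) (hH : H.Nonempty) :
    P.Nonempty :=
  let ⟨_, hh⟩ := hH
  let ⟨g, hg, _⟩ := exists_hdist_le_of_maximal hr hP hh
  ⟨g, hg⟩

theorem exists_maximal_packing {n : ℕ} (hn : ∀ P, IsPacking D H r P → P.card ≤ n) :
    ∃ P, Maximal (IsPacking D H r) P := by
  have hempty : ∃ P, IsPacking D H r P ∧ P.card = 0 := ⟨∅, by simp [IsPacking], rfl⟩
  obtain ⟨P, hP, hcard⟩ := Nat.findGreatest_spec (P := fun k => ∃ P, IsPacking D H r P ∧ P.card = k)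
    (Nat.zero_le n) hempty
  refine ⟨P, hP, fun Q hQ hPQ => (Finset.eq_of_subset_of_card_le hPQ ?_).ge⟩
  exact (Nat.le_findGreatest (hn Q hQ) ⟨Q, hQ, rfl⟩).trans_eq hcard.symm

theorem hdist_eq_sub_of_le [IsFiniteMeasure D] (hh : Measurable h) (hle : h ≤ g) :
    hdist D h g = D.real {x | g x = true} - D.real {x | h x = true} := by
  have hsub : {x | h x = true} ⊆ {x | g x = true} := fun x => Bool.le_iff_imp.1 (hle x)
  have hne : {x | h x ≠ g x} = {x | g x = true} \ {x | h x = true} := by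
    ext x
    have := Bool.le_iff_imp.1 (hle x)
    simp only [Set.mem_ofPred_eq, Set.mem_sdiff]
    grind
  rw [hdist, hne, measureReal_sdiff hsub (hh (measurableSet_singleton true))]

theorem hdist_eq_abs_sub [IsFiniteMeasure D] (hh : Measurable h) (hg : Measurable g)
    (htot : h ≤ g ∨ g ≤ h) :
    hdist D h g = |D.real {x | h x = true} - D.real {x | g x = true}| := by
  wlog hle : h ≤ g generalizing h g
  · rw [hdist_comm, abs_sub_comm]
    exact this hg hh htot.symm (htot.resolve_left hle)
  have hnonneg : 0 ≤ hdist D h g := measureReal_nonneg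
  rw [abs_sub_comm, ← hdist_eq_sub_of_le hh hle, abs_of_nonneg hnonneg]

theorem card_le_of_separated {β : Type*} {s : Finset β} {f : β → ℝ} {r : ℝ} (hr : 0 < r)
    (hf0 : ∀ b ∈ s, 0 ≤ f b) (hf1 : ∀ b ∈ s, f b ≤ 1)
    (hsep : ∀ a ∈ s, ∀ b ∈ s, a ≠ b → r < |f a - f b|) : (s.card : ℝ) ≤ 1 + 1 / r := by
  have hmaps : ∀ b ∈ s, ⌊f b / r⌋₊ ∈ Finset.range (⌊1 / r⌋₊ + 1) := fun b hb =>
    Finset.mem_range_succ_iff.2 (Nat.floor_le_floor (by gcongr; exact hf1 b hb))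
  have hinj : Set.InjOn (fun b => ⌊f b / r⌋₊) s := by
    intro a ha b hb heq
    by_contra hne
    have hlt : |f a / r - f b / r| < 1 := by
      simp only at heq
      have := Nat.floor_le (div_nonneg (hf0 a ha) hr.le)
      have := Nat.lt_floor_add_one (f a / r)
      have := Nat.floor_le (div_nonneg (hf0 b hb) hr.le)
      have := Nat.lt_floor_add_one (f b / r)
      rw [heq] at *
      rw [abs_lt]
      constructor <;> linarith
    rw [← sub_div, abs_div, abs_of_pos hr, div_lt_one hr] at hlt
    exact hlt.not_gt (hsep a ha b hb hne)
  have hcard : (s.card : ℝ) ≤ ⌊1 / r⌋₊ + 1 := by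
    exact_mod_cast (Finset.card_le_card_of_injOn _ hmaps hinj).trans_eq (Finset.card_range _)
  linarith [Nat.floor_le (one_div_pos.2 hr).le]

theorem IsPacking.card_le_of_isChain [IsProbabilityMeasure D] (hH : IsChain (· ≤ ·) H)
    (hm : ∀ h ∈ H, Measurable h) (hr : 0 < r) (hP : IsPacking D H r P) :
    (P.card : ℝ) ≤ 1 + 1 / r :=
  card_le_of_separated (f := fun h => D.real {x | h x = true}) hr (fun _ _ => measureReal_nonneg)
    (fun _ _ => measureReal_le_one) fun h hh g hg hne => by
      have hh' := hP.1 h hh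
      have hg' := hP.1 g hg
      exact hdist_eq_abs_sub (D := D) (hm h hh') (hm g hg') (hH.total hh' hg') ▸
        hP.2 h hh g hg hne

end Packing

/-! ### Informative queries for chains -/

section InformativeQueries

theorem sum_filter_sum_ge_lt {β : Type*} [PartialOrder β] {P : Finset β}
    (hP : IsChain (· ≤ ·) (P : Set β)) {l : β → ℝ} (hl : ∀ h ∈ P, 0 ≤ l h) {θ : ℝ} (hθ : 0 < θ) :
    ∑ h ∈ P with ∑ f ∈ P with h ≤ f, l f < θ, l h < θ := by
  set A := {h ∈ P | ∑ f ∈ P with h ≤ f, l f < θ}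
  rcases A.eq_empty_or_nonempty with hempty | hne
  · rwa [hempty, Finset.sum_empty]
  obtain ⟨g, hg⟩ := A.exists_minimal hne
  have hgA := Finset.mem_filter.1 hg.1
  have hsub : A ⊆ {f ∈ P | g ≤ f} := fun h hh =>
    have hhP := (Finset.mem_filter.1 hh).1
    Finset.mem_filter.2 ⟨hhP, (hP.total hgA.1 hhP).elim id (hg.2 hh)⟩
  exact (Finset.sum_le_sum_of_subset_of_nonneg hsub fun h hh _ =>
    hl h (Finset.mem_filter.1 hh).1).trans_lt hgA.2

theorem sum_filter_sum_le_lt {β : Type*} [PartialOrder β] {P : Finset β}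
    (hP : IsChain (· ≤ ·) (P : Set β)) {l : β → ℝ} (hl : ∀ h ∈ P, 0 ≤ l h) {θ : ℝ} (hθ : 0 < θ) :
    ∑ h ∈ P with ∑ f ∈ P with f ≤ h, l f < θ, l h < θ :=
  sum_filter_sum_ge_lt (β := βᵒᵈ) hP.symm hl hθ

variable {X : Type} {P : Finset (Hyp X)} {l : Hyp X → ℝ}

/-- The members of `P` that are not among the extreme tenths under `l` on either side. -/
def core (P : Finset (Hyp X)) (l : Hyp X → ℝ) : Finset (Hyp X) :=
  {h ∈ P | 1 / 10 ≤ mass l {f ∈ P | h ≤ f} ∧ 1 / 10 ≤ mass l {f ∈ P | f ≤ h}}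

theorem four_fifths_lt_mass_core (hP : IsChain (· ≤ ·) (P : Set (Hyp X)))
    (hl : IsProbVector P l) : 4 / 5 < mass l (core P l) := by
  set U := {h ∈ P | mass l {f ∈ P | h ≤ f} < 1 / 10} with hU
  set L := {h ∈ P | mass l {f ∈ P | f ≤ h} < 1 / 10} with hL
  have hUL : U ∪ L ⊆ P := Finset.union_subset (Finset.filter_subset _ _) (Finset.filter_subset _ _)
  have mass_U : mass l U < 1 / 10 := sum_filter_sum_ge_lt hP hl.nonneg (by norm_num)
  have mass_L : mass l L < 1 / 10 := sum_filter_sum_le_lt hP hl.nonneg (by norm_num)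
  have mass_UL := mass_union_le fun h hh => hl.nonneg h (hUL hh)
  have core_eq : core P l = P \ (U ∪ L) := by
    ext h
    simp only [core, hU, hL, Finset.mem_sdiff, Finset.mem_union, Finset.mem_filter, not_or,
      not_and, not_lt]
    tauto
  have hsplit := mass_sdiff_add l hUL
  rw [hl.mass_eq_one] at hsplit
  rw [core_eq]
  linarith

theorem IsProbVector.one_tenth_le_uncertainty (hl : IsProbVector P l) {f g : Hyp X}
    (hf : f ∈ core P l) (hg : g ∈ core P l) {x : X} (hfx : f x = false) (hgx : g x = true) :
    1 / 10 ≤ uncertainty P l x := by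
  have mass_true : 1 / 10 ≤ mass l (P.filter fun h => h x = true) :=
    (Finset.mem_filter.1 hg).2.1.trans <| hl.mass_mono (Finset.filter_subset _ _) <|
      Finset.monotone_filter_right P fun h _ hgh => Bool.le_iff_imp.1 (hgh x) hgx
  have mass_false : 1 / 10 ≤ mass l (P.filter fun h => ¬ h x = true) :=
    (Finset.mem_filter.1 hf).2.2.trans <| hl.mass_mono (Finset.filter_subset _ _) <|
      Finset.monotone_filter_right P fun h _ hhf hh =>
        Bool.false_ne_true (hfx.symm.trans (Bool.le_iff_imp.1 (hhf x) hh))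
  have hsplit := mass_filter_add_mass_filter_not l P fun h => h x = true
  rw [hl.mass_eq_one] at hsplit
  exact le_min mass_true (by linarith)

variable [MeasurableSpace X] {D : Measure X}

theorem IsProbVector.hdist_le_of_mem_core [IsFiniteMeasure D]
    (hP : IsChain (· ≤ ·) (P : Set (Hyp X))) (hl : IsProbVector P l) {f g : Hyp X}
    (hf : f ∈ core P l) (hg : g ∈ core P l) :
    hdist D f g ≤ D.real {x | 1 / 10 ≤ uncertainty P l x} := by
  have htot := hP.total (Finset.mem_of_mem_filter f hf) (Finset.mem_of_mem_filter g hg)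
  wlog hle : f ≤ g generalizing f g
  · rw [hdist_comm]
    exact this hg hf htot.symm (htot.resolve_left hle)
  refine measureReal_mono fun x hx => ?_
  obtain ⟨hfx, hgx⟩ : f x = false ∧ g x = true := by
    have := Bool.le_iff_imp.1 (hle x)
    simp only [Set.mem_ofPred_eq] at hx
    grind
  exact hl.one_tenth_le_uncertainty hf hg hfx hgx

theorem lt_measureReal_uncertain [IsFiniteMeasure D] (hP : IsChain (· ≤ ·) (P : Set (Hyp X)))
    (hl : IsProbVector P l) {R : ℝ} (hR : ¬ HasHeavyBall D P l R) :
    R < D.real {x | 1 / 10 ≤ uncertainty P l x} := by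
  have mass_core := four_fifths_lt_mass_core hP hl
  obtain ⟨μ, hμ⟩ : (core P l).Nonempty := by
    by_contra hempty
    rw [Finset.not_nonempty_iff_eq_empty.1 hempty, mass, Finset.sum_empty] at mass_core
    linarith
  by_contra! hle
  refine hR ⟨μ, Finset.mem_of_mem_filter μ hμ, mass_core.trans_le ?_⟩
  refine hl.mass_mono (ball_subset P μ R) fun h hh => Finset.mem_filter.2 ?_
  exact ⟨Finset.mem_of_mem_filter h hh, (hl.hdist_le_of_mem_core hP hμ hh).trans hle⟩

theorem sub_div_le_objective_cond [IsFiniteMeasure D] {A : Set X} (hA : MeasurableSet A)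
    (hDA : D A ≠ 0) {r : X → ℝ} (hr : Integrable r (cond D A)) {θ c : ℝ} (hc : 0 ≤ c)
    (hθ : ∀ x ∈ A, θ ≤ r x) : θ - c / D.real A ≤ objective D r c (cond D A) := by
  have : IsProbabilityMeasure (cond D A) := cond_isProbabilityMeasure hDA
  have reward : θ ≤ ∫ x, r x ∂(cond D A) := by
    have := integral_mono_ae (integrable_const θ) hr ((ae_cond_mem hA).mono hθ)
    rwa [integral_const, probReal_univ, one_smul] at this
  have ratio : (maxRatio (cond D A) D).toReal ≤ (D.real A)⁻¹ :=
    (ENNReal.toReal_mono (ENNReal.inv_ne_top.2 hDA) (maxRatio_le (cond_le_smul A))).trans_eq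
      (ENNReal.toReal_inv _)
  rw [objective, div_eq_mul_inv]
  gcongr

/-- As long as no ball of radius `R` is heavy under `l`, optimal queries with penalty `c` have
objective at least `v`.  This is all that the first stage needs to know about the class. -/
def HasInformativeQueries (D : Measure X) (P : Finset (Hyp X)) (R c v : ℝ) : Prop :=
  ∀ l, IsProbVector P l → ¬ HasHeavyBall D P l R →
    ∀ q, IsOptimalQuery D (uncertainty P l) c q → v ≤ objective D (uncertainty P l) c q

theorem hasInformativeQueries_of_isChain [IsFiniteMeasure D]
    (hP : IsChain (· ≤ ·) (P : Set (Hyp X))) (hm : ∀ h ∈ P, Measurable h) {R c : ℝ} (hc : 0 < c)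
    (hcR : 20 * c ≤ R) : HasInformativeQueries D P R c (1 / 20) := by
  intro l hl hheavy q hq
  set A := {x | 1 / 10 ≤ uncertainty P l x}
  have hAR : R < D.real A := lt_measureReal_uncertain hP hl hheavy
  have hApos : 0 < D.real A := by linarith
  have hDA : D A ≠ 0 := fun h0 => hApos.ne' (by rw [measureReal_def, h0, ENNReal.toReal_zero])
  have hAmeas : MeasurableSet A := measurableSet_le measurable_const (measurable_uncertainty hm l)
  have := cond_isProbabilityMeasure hDA
  have hfin : maxRatio (cond D A) D ≠ ⊤ :=
    ne_top_of_le_ne_top (ENNReal.inv_ne_top.2 hDA) (maxRatio_le (cond_le_smul A))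
  have penalty : c / D.real A ≤ 1 / 20 := by
    rw [div_le_iff₀ hApos]
    linarith
  calc (1 / 20 : ℝ) ≤ 1 / 10 - c / D.real A := by linarith
    _ ≤ objective D (uncertainty P l) c (cond D A) :=
        sub_div_le_objective_cond hAmeas hDA (hl.integrable_uncertainty hm _) hc.le fun x hx => hx
    _ ≤ objective D (uncertainty P l) c q := hq.2.2 _ inferInstance hfin

end InformativeQueries

/-! ### The potential of the first stage -/

section Potential

variable {X : Type} {P S A : Finset (Hyp X)} {w : Hyp X → ℝ} {g : Hyp X}

/-- The inverse square root of the product of the weight of `g` relative to `P` and its weight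
relative to `P \ S`: the capped distribution is the average of the two. -/
def potential (P : Finset (Hyp X)) (g : Hyp X) (w : Hyp X → ℝ) (S : Finset (Hyp X)) : ℝ :=
  Real.sqrt (mass w P * mass w (P \ S)) / w g

/-- A bound for the factor by which the label `y` at `x`, as `p = (x, y)`, multiplies the potential
if `r` is the uncertainty of the capped distribution. -/
def potentialFactor (r : X → ℝ) (g : Hyp X) (p : X × Bool) : ℝ :=
  1 - r p.1 / 6 + 1 / 4 * Set.indicator {p : X × Bool | g p.1 ≠ p.2} 1 p

/-- The relative weight of the hypotheses in `A` that the label `y` at `x` contradicts. -/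
def wrongShare (w : Hyp X → ℝ) (A : Finset (Hyp X)) (x : X) (y : Bool) : ℝ :=
  mass w (A.filter fun h => h x ≠ y) / mass w A

theorem one_le_potential (hw : ∀ h ∈ P, 0 < w h) (hg : g ∈ P \ S) : 1 ≤ potential P g w S := by
  have hgP := Finset.sdiff_subset hg
  have hw0 : ∀ h ∈ P, 0 ≤ w h := fun h hh => (hw h hh).le
  have weight_le : w g ≤ mass w P := Finset.single_le_sum hw0 hgP
  have weight_le_sdiff : w g ≤ mass w (P \ S) :=
    Finset.single_le_sum (fun h hh => hw0 h (Finset.sdiff_subset hh)) hg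
  rw [potential, one_le_div (hw g hgP)]
  refine Real.le_sqrt_of_sq_le ?_
  rw [sq]
  exact mul_le_mul weight_le weight_le_sdiff (hw0 g hgP) (mass_nonneg hw0)

theorem potential_nonneg (hg : 0 < w g) : 0 ≤ potential P g w S :=
  div_nonneg (Real.sqrt_nonneg _) hg.le

theorem potential_anti {S' : Finset (Hyp X)} (hw : ∀ h ∈ P, 0 < w h) (hg : g ∈ P) (hSS' : S ⊆ S') :
    potential P g w S' ≤ potential P g w S := by
  have hw0 : ∀ h ∈ P, 0 ≤ w h := fun h hh => (hw h hh).le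
  refine div_le_div_of_nonneg_right (Real.sqrt_le_sqrt ?_) (hw0 g hg)
  refine mul_le_mul_of_nonneg_left ?_ (mass_nonneg hw0)
  exact mass_mono (Finset.sdiff_subset_sdiff le_rfl hSS') fun h hh => hw0 h (Finset.sdiff_subset hh)

theorem potential_one_empty : potential P g (fun _ => 1) ∅ = P.card := by
  simp [potential, mass]

theorem reweight_pos {x : X} {y : Bool} {h : Hyp X} (hw : 0 < w h) : 0 < reweight P w x y h := by
  rw [reweight]
  split_ifs
  · exact mul_pos (Real.exp_pos _) hw
  · exact hw

theorem wrongShare_nonneg (hw : ∀ h ∈ A, 0 < w h) (x : X) (y : Bool) : 0 ≤ wrongShare w A x y :=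
  div_nonneg (mass_nonneg fun h hh => (hw h (Finset.mem_of_mem_filter h hh)).le)
    (mass_nonneg fun h hh => (hw h hh).le)

theorem wrongShare_le_one (hw : ∀ h ∈ A, 0 < w h) (x : X) (y : Bool) : wrongShare w A x y ≤ 1 :=
  div_le_one_of_le₀ (mass_mono (Finset.filter_subset _ _) fun h hh => (hw h hh).le)
    (mass_nonneg fun h hh => (hw h hh).le)

theorem mass_reweight (hA : A ⊆ P) (hwA : mass w A ≠ 0) (x : X) (y : Bool) :
    mass (reweight P w x y) A = mass w A * (1 - (1 - Real.exp (-α)) * wrongShare w A x y) := by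
  have hmass : mass (reweight P w x y) A =
      mass w A - (1 - Real.exp (-α)) * mass w (A.filter fun h => h x ≠ y) := by
    simp only [mass]
    rw [Finset.sum_filter, Finset.mul_sum, ← Finset.sum_sub_distrib]
    refine Finset.sum_congr rfl fun h hh => ?_
    by_cases hy : h x ≠ y
    · rw [reweight, if_pos ⟨hA hh, hy⟩, if_pos hy]
      ring
    · rw [reweight, if_neg fun hc => hy hc.2, if_neg hy]
      ring
  rw [hmass, wrongShare]
  field_simp

theorem uncertainty_capped_le (hw : ∀ h ∈ P, 0 < w h) (hSP : S ⊆ P) (hne : (P \ S).Nonempty)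
    (x : X) (y : Bool) : uncertainty P (capped (normalize P w) S) x ≤
      (wrongShare w P x y + wrongShare w (P \ S) x y) / 2 := by
  have hP : P.Nonempty := hne.mono Finset.sdiff_subset
  have hwP : mass w P ≠ 0 := (mass_pos hP hw).ne'
  have hS := mass_normalize_lt_one hw hSP hne
  have hwrong : (P.filter fun h => h x ≠ y) \ S = (P \ S).filter fun h => h x ≠ y := by
    ext h
    simp only [Finset.mem_sdiff, Finset.mem_filter]
    tauto
  have hcompl : 1 - mass w S / mass w P = mass w (P \ S) / mass w P := by
    rw [← mass_sdiff_add w hSP] at hwP ⊢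
    field_simp
    ring
  refine (((isProbVector_normalize hP hw).capped hSP hS).uncertainty_le_mass_wrong x y).trans_eq ?_
  rw [mass_capped hS, mass_normalize, mass_normalize, mass_normalize, hwrong, hcompl,
    div_div_div_cancel_right₀ hwP, wrongShare, wrongShare]
  ring

theorem exp_neg_α_le : Real.exp (-α) ≤ 5 / 6 := by
  rw [Real.exp_neg, inv_le_comm₀ (Real.exp_pos _) (by norm_num)]
  refine le_trans ?_ (Real.add_one_le_exp α)
  norm_num [α]

theorem exp_α_le : Real.exp α ≤ 5 / 4 := by
  rw [← inv_inv (Real.exp α), ← Real.exp_neg, inv_le_comm₀ (Real.exp_pos _) (by norm_num)]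
  refine le_trans ?_ (Real.add_one_le_exp (-α))
  norm_num [α]

theorem sqrt_mul_le_half_add {s t : ℝ} (hs : 0 ≤ s) (ht : 0 ≤ t) :
    Real.sqrt (s * t) ≤ (s + t) / 2 :=
  Real.sqrt_le_iff.2 ⟨by positivity, by linarith [sq_nonneg (s - t)]⟩

theorem sqrt_mass_reweight_le (hw : ∀ h ∈ P, 0 < w h) (hSP : S ⊆ P) (hne : (P \ S).Nonempty)
    (x : X) (y : Bool) :
    Real.sqrt (mass (reweight P w x y) P * mass (reweight P w x y) (P \ S)) ≤
      Real.sqrt (mass w P * mass w (P \ S)) *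
        (1 - uncertainty P (capped (normalize P w) S) x / 6) := by
  have hw' : ∀ h ∈ P \ S, 0 < w h := fun h hh => hw h (Finset.sdiff_subset hh)
  have hP := mass_pos (hne.mono Finset.sdiff_subset) hw
  have hPS := mass_pos hne hw'
  have hr := uncertainty_capped_le hw hSP hne x y
  have ha := wrongShare_nonneg hw x y
  have hb := wrongShare_nonneg hw' x y
  set a := wrongShare w P x y
  set b := wrongShare w (P \ S) x y
  set β := 1 - Real.exp (-α)
  have hβ6 : 1 / 6 ≤ β := by linarith [exp_neg_α_le]
  have hβ1 : β ≤ 1 := by linarith [Real.exp_pos (-α)]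
  have hβa : β * a ≤ 1 := mul_le_one₀ hβ1 ha (wrongShare_le_one hw x y)
  have hβb : β * b ≤ 1 := mul_le_one₀ hβ1 hb (wrongShare_le_one hw' x y)
  rw [mass_reweight le_rfl hP.ne', mass_reweight Finset.sdiff_subset hPS.ne', mul_mul_mul_comm,
    Real.sqrt_mul (by positivity)]
  gcongr
  calc Real.sqrt ((1 - β * a) * (1 - β * b)) ≤ ((1 - β * a) + (1 - β * b)) / 2 :=
        sqrt_mul_le_half_add (by linarith) (by linarith)
    _ = 1 - β * ((a + b) / 2) := by ring
    _ ≤ 1 - 1 / 6 * ((a + b) / 2) := by gcongr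
    _ ≤ _ := by linarith

theorem potential_reweight_le (hw : ∀ h ∈ P, 0 < w h) (hSP : S ⊆ P) (hg : g ∈ P \ S) (x : X)
    (y : Bool) : potential P g (reweight P w x y) S ≤
      potential P g w S *
        potentialFactor (uncertainty P (capped (normalize P w) S)) g (x, y) := by
  have hgP := Finset.sdiff_subset hg
  have hwg := hw g hgP
  have hsqrt := sqrt_mass_reweight_le hw hSP ⟨g, hg⟩ x y
  have hr : 0 ≤ uncertainty P (capped (normalize P w) S) x :=
    ((isProbVector_normalize ⟨g, hgP⟩ hw).capped hSP
      (mass_normalize_lt_one hw hSP ⟨g, hg⟩)).uncertainty_nonneg x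
  simp only [potential, potentialFactor]
  set r := uncertainty P (capped (normalize P w) S) x
  set s := Real.sqrt (mass w P * mass w (P \ S))
  by_cases hy : g x ≠ y
  · have hs : 0 ≤ s * (1 - r / 6) := (Real.sqrt_nonneg _).trans hsqrt
    rw [reweight, if_pos ⟨hgP, hy⟩, Set.indicator_of_mem (by exact hy), Pi.one_apply]
    calc _ ≤ s * (1 - r / 6) / (Real.exp (-α) * w g) := by gcongr
      _ = Real.exp α * (s * (1 - r / 6)) / w g := by
          rw [Real.exp_neg]
          field_simp
      _ ≤ 5 / 4 * (s * (1 - r / 6)) / w g := by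
          gcongr
          exact exp_α_le
      _ = s / w g * (5 / 4 * (1 - r / 6)) := by ring
      _ ≤ _ := by
          refine mul_le_mul_of_nonneg_left ?_ (div_nonneg (Real.sqrt_nonneg _) hwg.le)
          linarith
  · rw [reweight, if_neg fun hc => hy hc.2, Set.indicator_of_notMem (by exact hy), mul_zero,
      add_zero, div_mul_eq_mul_div]
    gcongr

end Potential

/-! ### The first stage -/

section PotentialDrop

variable {X : Type} [MeasurableSpace X] {D : Measure X} {κ : Kernel X Bool} [IsMarkovKernel κ]
  {q : Measure X} [IsProbabilityMeasure q] {g : Hyp X} {r : X → ℝ}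

theorem measurable_potentialFactor (hr : Measurable r) (hg : Measurable g) :
    Measurable (potentialFactor r g) :=
  (((hr.comp measurable_fst).div_const 6).const_sub 1).add
    ((measurable_one.indicator (measurableSet_wrong hg)).const_mul _)

theorem integrable_indicator_wrong (hg : Measurable g) :
    Integrable ({p : X × Bool | g p.1 ≠ p.2}.indicator (1 : X × Bool → ℝ)) (q ⊗ₘ κ) :=
  (integrable_const (1 : ℝ)).indicator (measurableSet_wrong hg)

theorem integrable_comp_fst (hr : Integrable r q) : Integrable (fun p => r p.1) (q ⊗ₘ κ) :=
  Integrable.comp_measurable (g := r) (by rwa [← Measure.fst, Measure.fst_compProd]) measurable_fst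

theorem integrable_potentialFactor (hr : Integrable r q) (hg : Measurable g) :
    Integrable (potentialFactor r g) (q ⊗ₘ κ) :=
  ((integrable_const 1).sub ((integrable_comp_fst hr).div_const 6)).add
    ((integrable_indicator_wrong hg).const_mul _)

theorem integral_potentialFactor (hrm : Measurable r) (hr : Integrable r q) (hg : Measurable g) :
    ∫ p, potentialFactor r g p ∂(q ⊗ₘ κ) =
      1 - (∫ x, r x ∂q) / 6 + 1 / 4 * err (q ⊗ₘ κ) g := by
  have hfst : ∫ p, r p.1 ∂(q ⊗ₘ κ) = ∫ x, r x ∂q := by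
    conv_rhs => rw [← Measure.fst_compProd q κ, Measure.fst]
    exact (integral_map measurable_fst.aemeasurable hrm.aestronglyMeasurable).symm
  have hr6 := (integrable_comp_fst (κ := κ) hr).div_const 6
  have hleft := (integrable_const (μ := q ⊗ₘ κ) (1 : ℝ)).sub hr6
  calc ∫ p, potentialFactor r g p ∂(q ⊗ₘ κ) = ∫ p, (1 - r p.1 / 6) ∂(q ⊗ₘ κ) +
        ∫ p, 1 / 4 * {p : X × Bool | g p.1 ≠ p.2}.indicator 1 p ∂(q ⊗ₘ κ) :=
        integral_add hleft ((integrable_indicator_wrong hg).const_mul _)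
    _ = _ := by
        rw [integral_sub (integrable_const 1) hr6, integral_div, hfst, integral_const_mul,
          integral_indicator_one (measurableSet_wrong hg), integral_const, probReal_univ, one_smul,
          err]

theorem integral_potentialFactor_le [IsFiniteMeasure D] (hq : maxRatio q D ≠ ⊤)
    (hrm : Measurable r) (hr : Integrable r q) (hg : Measurable g) {c v : ℝ}
    (herr : 3 / 2 * err (D ⊗ₘ κ) g ≤ c) (hv : v ≤ objective D r c q) :
    ∫ p, potentialFactor r g p ∂(q ⊗ₘ κ) ≤ 1 - v / 6 := by
  have hwrong := err_compProd_le (κ := κ) hq (le_maxRatio_smul hq) hg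
  have hcost := mul_le_mul_of_nonneg_left herr (maxRatio q D).toReal_nonneg
  rw [objective] at hv
  rw [integral_potentialFactor hrm hr hg]
  linarith

end PotentialDrop

section StageOne

variable {X : Type} [MeasurableSpace X] {D : Measure X} {H : Set (Hyp X)} {c₄ c₅ η ε : ℝ}
  {ch : Choices D H c₄ c₅ η ε} {s : State X} {g : Hyp X}

/-- The invariants of the first stage.  The second stage searches for a good hypothesis among the
centers, so each covered hypothesis must have one nearby. -/
structure State.Valid (ch : Choices D H c₄ c₅ η ε) (s : State X) : Prop where
  w_pos : ∀ h ∈ ch.pack, 0 < s.w h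
  S_subset : s.S ⊆ ch.pack
  C_subset : s.C ⊆ ch.pack
  cover : ∀ h ∈ s.S, ∃ μ ∈ s.C, hdist D μ h ≤ 3 * radius c₄ c₅ η ε

theorem State.valid_init (ch : Choices D H c₄ c₅ η ε) :
    State.Valid ch { w := fun _ => 1, S := ∅, C := ∅ } where
  w_pos _ _ := one_pos
  S_subset := Finset.empty_subset _
  C_subset := Finset.empty_subset _
  cover h hh := absurd hh (Finset.notMem_empty h)

theorem expand_w (ch : Choices D H c₄ c₅ η ε) (s : State X) : (expand ch s).w = s.w := by
  rw [expand]
  split_ifs <;> rfl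

theorem subset_expand_S (ch : Choices D H c₄ c₅ η ε) (s : State X) : s.S ⊆ (expand ch s).S := by
  rw [expand]
  split_ifs
  · exact Finset.subset_union_left
  · exact le_rfl

theorem card_expand_C_le (ch : Choices D H c₄ c₅ η ε) (s : State X) :
    (expand ch s).C.card ≤ s.C.card + 1 := by
  rw [expand]
  split_ifs
  · exact Finset.card_insert_le _ _
  · exact Nat.le_succ _

theorem State.Valid.expand (hs : s.Valid ch) : (expand ch s).Valid ch := by
  rw [ActiveLearning.expand]
  split_ifs
  · refine ⟨hs.w_pos, Finset.union_subset hs.S_subset (ball_subset _ _ _),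
      Finset.insert_subset (ch.center_spec _).1 hs.C_subset, fun h hh => ?_⟩
    rcases Finset.mem_union.1 hh with hhS | hball
    · obtain ⟨μ, hμ, hdist⟩ := hs.cover h hhS
      exact ⟨μ, Finset.mem_insert_of_mem hμ, hdist⟩
    · exact ⟨_, Finset.mem_insert_self _ _, (Finset.mem_filter.1 hball).2⟩
  · exact hs

theorem State.Valid.reweight (hs : s.Valid ch) (x : X) (y : Bool) :
    State.Valid ch { w := reweight ch.pack s.w x y, S := s.S, C := s.C } where
  w_pos h hh := reweight_pos (hs.w_pos h hh)
  S_subset := hs.S_subset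
  C_subset := hs.C_subset
  cover := hs.cover

theorem State.Valid.isProbVector_capped (hs : s.Valid ch) (hg : g ∈ ch.pack \ s.S) :
    IsProbVector ch.pack (capped (normalize ch.pack s.w) s.S) :=
  (isProbVector_normalize ⟨g, Finset.sdiff_subset hg⟩ hs.w_pos).capped hs.S_subset
    (mass_normalize_lt_one hs.w_pos hs.S_subset ⟨g, hg⟩)

theorem not_hasHeavyBall_expand [IsFiniteMeasure D] (hs : s.Valid ch)
    (hg : g ∈ ch.pack \ (expand ch s).S) :
    ¬ HasHeavyBall D ch.pack (capped (normalize ch.pack (expand ch s).w) (expand ch s).S)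
      (radius c₄ c₅ η ε) := by
  have hlt := mass_normalize_lt_one hs.expand.w_pos hs.expand.S_subset ⟨g, hg⟩
  by_cases hheavy : HasHeavyBall D ch.pack (capped (normalize ch.pack s.w) s.S) (radius c₄ c₅ η ε)
  · rw [expand, if_pos hheavy] at hlt ⊢
    exact not_hasHeavyBall_capped_union
      (isProbVector_normalize ⟨g, Finset.sdiff_subset hg⟩ hs.w_pos) hs.S_subset
      (ch.center_spec _) hlt hheavy
  · rwa [expand, if_neg hheavy]

/-- The potential of a state of the first stage, which is zero once `g` is covered. -/
def statePotential (P : Finset (Hyp X)) (g : Hyp X) (s : State X) : ℝ :=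
  if g ∈ s.S then 0 else potential P g s.w s.S

theorem State.Valid.statePotential_nonneg (hs : s.Valid ch) (hg : g ∈ ch.pack) :
    0 ≤ statePotential ch.pack g s := by
  rw [statePotential]
  split_ifs
  · exact le_rfl
  · exact potential_nonneg (hs.w_pos g hg)

theorem State.Valid.statePotential_expand_le (hs : s.Valid ch) (hg : g ∈ ch.pack) :
    statePotential ch.pack g (ActiveLearning.expand ch s) ≤ statePotential ch.pack g s := by
  by_cases hgS : g ∈ (ActiveLearning.expand ch s).S
  · rw [statePotential, if_pos hgS]
    exact hs.statePotential_nonneg hg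
  · rw [statePotential, if_neg hgS, statePotential,
      if_neg fun hgs => hgS (subset_expand_S ch s hgs), expand_w]
    exact potential_anti hs.w_pos hg (subset_expand_S ch s)

theorem State.Valid.query_failsAtMost [IsFiniteMeasure D] {κ : Kernel X Bool} [IsMarkovKernel κ]
    {v : ℝ} (hP : ∀ h ∈ ch.pack, Measurable h)
    (hv : HasInformativeQueries D ch.pack (radius c₄ c₅ η ε) (c₄ / 20 * η) v)
    (hg : g ∈ ch.pack) (herr : 3 / 2 * err (D ⊗ₘ κ) g ≤ c₄ / 20 * η) (hs : s.Valid ch)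
    (hheavy : g ∈ ch.pack \ s.S →
      ¬ HasHeavyBall D ch.pack (capped (normalize ch.pack s.w) s.S) (radius c₄ c₅ η ε))
    {Out : Type} {good : Set Out} {next : X → Bool → Prog X Out} {m : ℕ} {a : ℝ} (ha : 0 ≤ a)
    (hnext : ∀ x y, (next x y).FailsAtMost κ good m (a * statePotential ch.pack g
      { w := ActiveLearning.reweight ch.pack s.w x y, S := s.S, C := s.C })) :
    (Prog.query (ch.queryDist (capped (normalize ch.pack s.w) s.S)) next).FailsAtMost κ good (m + 1)
      (a * statePotential ch.pack g s * (1 - v / 6)) := by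
  have hopt := ch.queryDist_spec (capped (normalize ch.pack s.w) s.S)
  have := hopt.1
  by_cases hgS : g ∈ s.S
  · simp only [statePotential, if_pos hgS, mul_zero, zero_mul] at hnext ⊢
    simpa using Prog.FailsAtMost.query measurable_zero (integrable_zero _ _ _) hnext
  have hgPS : g ∈ ch.pack \ s.S := Finset.mem_sdiff.2 ⟨hg, hgS⟩
  have hl := hs.isProbVector_capped hgPS
  have hr := hl.integrable_uncertainty hP (ch.queryDist (capped (normalize ch.pack s.w) s.S))
  simp only [statePotential, if_neg hgS] at hnext ⊢
  refine .query_mul (mul_nonneg ha (potential_nonneg (hs.w_pos g hg)))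
    (measurable_potentialFactor (measurable_uncertainty hP _) (hP g hg))
    (integrable_potentialFactor hr (hP g hg))
    (integral_potentialFactor_le hopt.2.1 (measurable_uncertainty hP _) hr (hP g hg) herr
      (hv _ hl (hheavy hgPS) _ hopt)) fun x y => (hnext x y).mono le_rfl ?_
  rw [mul_assoc]
  exact mul_le_mul_of_nonneg_left (potential_reweight_le hs.w_pos hs.S_subset hgPS x y) ha

/-- The states in which the first stage succeeds when `g` is to be covered by at most `k`
centers. -/
def coveredStates (ch : Choices D H c₄ c₅ η ε) (g : Hyp X) (k : ℕ) : Set (State X) :=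
  {s | s.Valid ch ∧ g ∈ s.S ∧ s.C.card ≤ k}

theorem stage₁_failsAtMost [IsFiniteMeasure D] {κ : Kernel X Bool} [IsMarkovKernel κ] {v : ℝ}
    (hP : ∀ h ∈ ch.pack, Measurable h)
    (hv : HasInformativeQueries D ch.pack (radius c₄ c₅ η ε) (c₄ / 20 * η) v) (hv6 : v ≤ 6)
    (hg : g ∈ ch.pack) (herr : 3 / 2 * err (D ⊗ₘ κ) g ≤ c₄ / 20 * η) {k n : ℕ}
    (hs : s.Valid ch) (hk : s.C.card + n ≤ k) :
    (stage₁ ch n s).FailsAtMost κ (coveredStates ch g k) n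
      (statePotential ch.pack g s * (1 - v / 6) ^ n) := by
  induction n generalizing s with
  | zero =>
    rw [stage₁, pow_zero, mul_one, statePotential]
    split_ifs with hgS
    · exact .ret (good := coveredStates ch g k) ⟨hs, hgS, hk⟩ 0 le_rfl
    · exact .of_one_le _ _ (one_le_potential hs.w_pos (Finset.mem_sdiff.2 ⟨hg, hgS⟩))
  | succ n ih =>
    have hpow : 0 ≤ (1 - v / 6) ^ n := pow_nonneg (by linarith) n
    refine (hs.expand.query_failsAtMost hP hv hg herr (not_hasHeavyBall_expand hs) hpow
      fun x y => (ih (hs.expand.reweight x y) ?_).mono le_rfl (mul_comm _ _).le).mono le_rfl ?_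
    · have := card_expand_C_le ch s
      simp only
      omega
    · rw [mul_right_comm, ← pow_succ, mul_comm]
      exact mul_le_mul_of_nonneg_right (hs.statePotential_expand_le hg)
        (pow_nonneg (by linarith) _)

end StageOne

/-! ### The second stage -/

section CountErrors

variable {X : Type} [MeasurableSpace X] {κ : Kernel X Bool} [IsMarkovKernel κ] {h : Hyp X}

-- The bound is multiplied by `a` for every wrong label and by `b` for every right one, so `ρ`
-- bounds its expected growth per query.
theorem countErrors_failsAtMost {q : Measure X} [IsProbabilityMeasure q] (hh : Measurable h)
    {a b ρ : ℝ} (ha : 0 ≤ a) (hb : 0 ≤ b) (hρ0 : 0 ≤ ρ) (hρ : b + (a - b) * err (q ⊗ₘ κ) h ≤ ρ)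
    {good : Set ℕ} {t : ℕ} (hgood : ∀ i j, i + j = t → i ∉ good → 1 ≤ a ^ i * b ^ j)
    {n i j : ℕ} (hij : i + j + n = t) :
    (countErrors q h n i).FailsAtMost κ good n (a ^ i * b ^ j * ρ ^ n) := by
  induction n generalizing i j with
  | zero =>
    rw [countErrors, pow_zero, mul_one]
    by_cases hi : i ∈ good
    · exact .ret hi 0 (by positivity)
    · exact .of_one_le _ 0 (hgood i j hij hi)
  | succ n ih =>
    set wrong := {p : X × Bool | h p.1 ≠ p.2}
    have hind : Integrable (wrong.indicator (1 : X × Bool → ℝ)) (q ⊗ₘ κ) :=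
      integrable_indicator_wrong hh
    have hmean : ∫ p, (b + (a - b) * wrong.indicator 1 p) ∂(q ⊗ₘ κ) ≤ ρ := by
      rwa [integral_add (integrable_const b) (hind.const_mul _), integral_const, probReal_univ,
        one_smul, integral_const_mul, integral_indicator_one (measurableSet_wrong hh)]
    rw [countErrors, pow_succ, ← mul_assoc]
    refine .query_mul (by positivity)
      (((measurable_one.indicator (measurableSet_wrong hh)).const_mul (a - b)).const_add b)
      ((integrable_const b).add (hind.const_mul _)) hmean fun x y => ?_
    by_cases hy : h x ≠ y
    · rw [if_pos hy, Set.indicator_of_mem (by exact hy), Pi.one_apply]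
      exact (ih (i := i + 1) (j := j) (by omega)).mono le_rfl (by rw [pow_succ]; linarith)
    · rw [if_neg hy, Set.indicator_of_notMem (by exact hy)]
      exact (ih (i := i) (j := j + 1) (by omega)).mono le_rfl (by rw [pow_succ]; linarith)

theorem one_le_pow_mul_pow {a b : ℝ} (ha : 0 < a) (hb : 1 ≤ b) (hab : a * b = 1) {i j : ℕ}
    (hij : i ≤ j) : 1 ≤ a ^ i * b ^ j := by
  calc (1 : ℝ) = a ^ i * b ^ i := by rw [← mul_pow, hab, one_pow]
    _ ≤ a ^ i * b ^ j := by gcongr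

theorem countErrors_failsAtMost_of_err_le {q : Measure X} [IsProbabilityMeasure q]
    (hh : Measurable h) (herr : err (q ⊗ₘ κ) h ≤ 1 / 3) {good : Set ℕ} {t : ℕ}
    (hgood : ∀ e, 2 * e < t → e ∈ good) :
    (countErrors q h t 0).FailsAtMost κ good t ((17 / 18) ^ t) := by
  have hbad : ∀ i j, i + j = t → i ∉ good → 1 ≤ (3 / 2 : ℝ) ^ i * (2 / 3) ^ j :=
    fun i j hij hi => by
      have : ¬ 2 * i < t := mt (hgood i) hi
      rw [mul_comm]
      exact one_le_pow_mul_pow (by norm_num) (by norm_num) (by norm_num) (by omega)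
  simpa using countErrors_failsAtMost hh (by norm_num) (by norm_num)
    (by norm_num : (0 : ℝ) ≤ 17 / 18) (by linarith) hbad (j := 0) (zero_add t)

theorem countErrors_failsAtMost_of_le_err {q : Measure X} [IsProbabilityMeasure q]
    (hh : Measurable h) (herr : 2 / 3 ≤ err (q ⊗ₘ κ) h) {good : Set ℕ} {t : ℕ}
    (hgood : ∀ e, t ≤ 2 * e → e ∈ good) :
    (countErrors q h t 0).FailsAtMost κ good t ((17 / 18) ^ t) := by
  have hbad : ∀ i j, i + j = t → i ∉ good → 1 ≤ (2 / 3 : ℝ) ^ i * (3 / 2) ^ j :=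
    fun i j hij hi => by
      have : ¬ t ≤ 2 * i := mt (hgood i) hi
      exact one_le_pow_mul_pow (by norm_num) (by norm_num) (by norm_num) (by omega)
  simpa using countErrors_failsAtMost hh (by norm_num) (by norm_num)
    (by norm_num : (0 : ℝ) ≤ 17 / 18) (by linarith) hbad (j := 0) (zero_add t)

end CountErrors

section Comparison

variable {X : Type} [MeasurableSpace X] {D : Measure X} {κ : Kernel X Bool} [IsMarkovKernel κ]
  {h g h₀ : Hyp X}

theorem err_cond_le [IsFiniteMeasure D] (hh : Measurable h) {A : Set X} {ν : ℝ} (hν : 0 < ν)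
    (herr : err (D ⊗ₘ κ) h ≤ ν) (hA : 3 * ν ≤ D.real A) :
    err (ProbabilityTheory.cond D A ⊗ₘ κ) h ≤ 1 / 3 := by
  have hpos : 0 < D.real A := by linarith
  have hDA : D A ≠ 0 := fun h0 => hpos.ne' (by rw [measureReal_def, h0, ENNReal.toReal_zero])
  refine (err_compProd_le (ENNReal.inv_ne_top.2 hDA) (cond_le_smul A) hh).trans ?_
  rw [ENNReal.toReal_inv, ← measureReal_def, inv_mul_le_iff₀ hpos]
  linarith

theorem one_le_err_cond_add_err_cond [IsFiniteMeasure D] (hh : Measurable h) (hg : Measurable g)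
    (hne : D {x | h x ≠ g x} ≠ 0) :
    1 ≤ err (ProbabilityTheory.cond D {x | h x ≠ g x} ⊗ₘ κ) h +
      err (ProbabilityTheory.cond D {x | h x ≠ g x} ⊗ₘ κ) g := by
  have := cond_isProbabilityMeasure hne
  refine le_trans ?_ (hdist_le_err_add_err (Measure.fst_compProd _ κ) hh hg)
  rw [hdist, measureReal_def, cond_apply_self hne (measure_ne_top D _), ENNReal.toReal_one]

theorem comparison_failsAtMost [IsFiniteMeasure D] (hh : Measurable h) (hg : Measurable g) {ν : ℝ}
    (hν : 0 < ν) (herr : err (D ⊗ₘ κ) h₀ ≤ ν) (hfar : 3 * ν ≤ hdist D h g) (t : ℕ) :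
    (countErrors (ProbabilityTheory.cond D {x | h x ≠ g x}) h t 0).FailsAtMost κ
      {e | (if t ≤ 2 * e then h else g) ≠ h₀} t ((17 / 18) ^ t) := by
  have hpos : 0 < D.real {x | h x ≠ g x} := lt_of_lt_of_le (by linarith) hfar
  have hDA : D {x | h x ≠ g x} ≠ 0 := fun h0 =>
    hpos.ne' (by rw [measureReal_def, h0, ENNReal.toReal_zero])
  have := cond_isProbabilityMeasure hDA
  have hne : h ≠ g := by
    rintro rfl
    rw [hdist_self] at hfar
    linarith
  by_cases hh₀ : h = h₀
  · have hh_err := err_cond_le hh hν (hh₀ ▸ herr) hfar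
    refine countErrors_failsAtMost_of_err_le hh hh_err fun e he => ?_
    rw [Set.mem_ofPred_eq, if_neg he.not_ge, ← hh₀]
    exact hne.symm
  have hgood : ∀ e, t ≤ 2 * e → e ∈ {e | (if t ≤ 2 * e then h else g) ≠ h₀} := fun e he => by
    rwa [Set.mem_ofPred_eq, if_pos he]
  by_cases hg₀ : g = h₀
  · have hg_err := err_cond_le hg hν (hg₀ ▸ herr) hfar
    have hsum := one_le_err_cond_add_err_cond (κ := κ) hh hg hDA
    exact countErrors_failsAtMost_of_le_err hh (by linarith) hgood
  · have hgood' : ∀ e, e ∈ {e | (if t ≤ 2 * e then h else g) ≠ h₀} := fun e => by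
      rw [Set.mem_ofPred_eq]
      split_ifs <;> assumption
    simpa using countErrors_failsAtMost (κ := κ) (ρ := 17 / 18) hh le_rfl le_rfl (by norm_num)
      (by norm_num) (fun i _ _ hi => absurd (hgood' i) hi) (j := 0) (zero_add t)

end Comparison

section StageTwo

variable {X : Type} [MeasurableSpace X] {D : Measure X} {H : Set (Hyp X)} {c₄ c₅ η ε : ℝ}

theorem stage₂_failsAtMost [IsFiniteMeasure D] {κ : Kernel X Bool} [IsMarkovKernel κ]
    (ch : Choices D H c₄ c₅ η ε) (hν : 0 < noise₂ c₄ c₅ η ε) {h₀ : Hyp X}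
    (herr : err (D ⊗ₘ κ) h₀ ≤ noise₂ c₄ c₅ η ε) {good : Set (Hyp X)} (t : ℕ) {n : ℕ}
    {F : Finset (Hyp X)} (h₀F : h₀ ∈ F) (hF : ∀ h ∈ F, Measurable h)
    (hgood : ∀ h ∈ F, hdist D h h₀ < 3 * noise₂ c₄ c₅ η ε → h ∈ good) (hcard : F.card ≤ n) :
    (stage₂ ch t n F).FailsAtMost κ good (n * t) ((F.card - 1) * (17 / 18) ^ t) := by
  induction n generalizing F with
  | zero => exact absurd (Finset.card_pos.2 ⟨h₀, h₀F⟩) (by omega)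
  | succ n ih =>
    have hcard_pos : (1 : ℝ) ≤ F.card := by exact_mod_cast Finset.card_pos.2 ⟨h₀, h₀F⟩
    rw [stage₂]
    split_ifs with hfar
    · obtain ⟨hp₁, hp₂, hp⟩ := ch.pair_spec F hfar
      have hne : (ch.pair F).1 ≠ (ch.pair F).2 := fun he => by
        rw [he, hdist_self] at hp
        linarith
      have hcard_two : (2 : ℝ) ≤ F.card := by
        exact_mod_cast Finset.one_lt_card.2 ⟨_, hp₁, _, hp₂, hne⟩
      refine ((comparison_failsAtMost (hF _ hp₁) (hF _ hp₂) hν herr hp t).bind (m' := n * t)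
        (b := (F.card - 2) * (17 / 18) ^ t) (by positivity)
        (mul_nonneg (by linarith) (by positivity)) fun e he => ?_).mono
        (by rw [Nat.succ_mul, add_comm]) (by linarith)
      have hfF : (if t ≤ 2 * e then (ch.pair F).1 else (ch.pair F).2) ∈ F := by
        split_ifs <;> assumption
      have hcard_erase := Finset.card_erase_add_one hfF
      refine (ih (Finset.mem_erase.2 ⟨Ne.symm he, h₀F⟩)
        (fun h hh => hF h (Finset.mem_of_mem_erase hh))
        (fun h hh => hgood h (Finset.mem_of_mem_erase hh)) (by omega)).mono le_rfl ?_
      rw [← hcard_erase, Nat.cast_add, Nat.cast_one]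
      exact le_of_eq (by ring)
    · push Not at hfar
      have hout := ch.out_spec F ⟨h₀, h₀F⟩
      exact .ret (hgood _ hout (hfar _ hout _ h₀F)) _ (mul_nonneg (by linarith) (by positivity))

end StageTwo

/-! ### The competitive algorithm -/

section Repetitions

variable {K δ : ℝ}

/-- The number of rounds of the first stage for `N` hypotheses, and of queries per comparison of
the second stage for `N` candidates. -/
def repetitions (K δ : ℝ) (N : ℕ) : ℕ := ⌈K * Real.log (N / δ)⌉₊

theorem repetitions_mono (hK : 0 ≤ K) (hδ : 0 < δ) {k n : ℕ} (hk : 0 < k) (hkn : k ≤ n) :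
    repetitions K δ k ≤ repetitions K δ n := by
  have : (0 : ℝ) < k := by exact_mod_cast hk
  rw [repetitions, repetitions]
  gcongr

theorem pow_repetitions_le {ρ : ℝ} {a N : ℕ} (hρ0 : 0 ≤ ρ) (hρ1 : ρ ≤ 1) (hK : a ≤ K * (1 - ρ))
    (hN : 0 < N) (hδ : 0 < δ) (hδ1 : δ ≤ 1) : ρ ^ repetitions K δ N ≤ (δ / N) ^ a := by
  have hN' : (1 : ℝ) ≤ N := by exact_mod_cast hN
  have hlog : 0 ≤ Real.log (N / δ) := Real.log_nonneg ((one_le_div hδ).2 (by linarith))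
  have hexp : a * Real.log (N / δ) ≤ repetitions K δ N * (1 - ρ) :=
    calc a * Real.log (N / δ) ≤ K * (1 - ρ) * Real.log (N / δ) := by gcongr
      _ = K * Real.log (N / δ) * (1 - ρ) := by ring
      _ ≤ _ := mul_le_mul_of_nonneg_right (Nat.le_ceil _) (by linarith)
  calc ρ ^ repetitions K δ N ≤ Real.exp (-(1 - ρ)) ^ repetitions K δ N :=
        pow_le_pow_left₀ hρ0 (by linarith [Real.add_one_le_exp (-(1 - ρ))]) _
    _ = Real.exp (-(repetitions K δ N * (1 - ρ))) := by rw [← Real.exp_nat_mul, mul_neg]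
    _ ≤ Real.exp (a * -Real.log (N / δ)) := Real.exp_le_exp.2 (by linarith)
    _ = (δ / N) ^ a := by
        rw [Real.exp_nat_mul, ← Real.log_inv, inv_div, Real.exp_log (by positivity)]

end Repetitions

section CompetitiveAlgorithm

variable {X : Type} [MeasurableSpace X] {D : Measure X} {H : Set (Hyp X)} {c₄ c₅ η ε δ : ℝ}

theorem Choices.exists_err_le [IsProbabilityMeasure D] (ch : Choices D H c₄ c₅ η ε)
    {κ : Kernel X Bool} [IsMarkovKernel κ] (hH : ∀ h ∈ H, Measurable h) (hη : 0 ≤ η)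
    (hopt : ∃ h ∈ H, err (D ⊗ₘ κ) h ≤ η) : ∃ g ∈ ch.pack, err (D ⊗ₘ κ) g ≤ 3 * η := by
  obtain ⟨h, hh, herr⟩ := hopt
  obtain ⟨g, hg, hgh⟩ := exists_hdist_le_of_maximal (by positivity) ch.pack_spec hh
  have := err_le_err_add_hdist (Measure.fst_compProd D κ) (hH g (ch.pack_spec.1.1 g hg)) (hH h hh)
  exact ⟨g, hg, by linarith⟩

theorem stage₁_failsAtMost_div [IsFiniteMeasure D] {κ : Kernel X Bool} [IsMarkovKernel κ]
    (ch : Choices D H c₄ c₅ η ε) {K₁ v : ℝ} (hP : ∀ h ∈ ch.pack, Measurable h)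
    (hv : HasInformativeQueries D ch.pack (radius c₄ c₅ η ε) (c₄ / 20 * η) v) (hv0 : 0 ≤ v)
    (hv6 : v ≤ 6) (hK₁ : 12 ≤ K₁ * v) (hδ : 0 < δ) (hδ1 : δ ≤ 1) {g : Hyp X} (hg : g ∈ ch.pack)
    (herr : 3 / 2 * err (D ⊗ₘ κ) g ≤ c₄ / 20 * η) {n : ℕ}
    (hn : n = repetitions K₁ δ ch.pack.card) :
    (stage₁ ch n { w := fun _ => 1, S := ∅, C := ∅ }).FailsAtMost κ (coveredStates ch g n) n
      (δ / ch.pack.card) := by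
  have hcard := Finset.card_pos.2 ⟨g, hg⟩
  have hpow := pow_repetitions_le (ρ := 1 - v / 6) (K := K₁) (a := 2) (by linarith) (by linarith)
    (by push_cast; linarith) hcard hδ hδ1
  rw [← hn] at hpow
  refine (stage₁_failsAtMost hP hv hv6 hg herr (State.valid_init ch) (by simp)).mono le_rfl ?_
  rw [statePotential, if_neg (Finset.notMem_empty g), potential_one_empty]
  have : (0 : ℝ) < ch.pack.card := by exact_mod_cast hcard
  calc (ch.pack.card : ℝ) * (1 - v / 6) ^ n ≤ ch.pack.card * (δ / ch.pack.card) ^ 2 := by gcongr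
    _ = δ * δ / ch.pack.card := by field_simp
    _ ≤ δ / ch.pack.card := by
        gcongr
        exact mul_le_of_le_one_left hδ.le hδ1

theorem stage₂_failsAtMost_sub_div [IsProbabilityMeasure D] {κ : Kernel X Bool} [IsMarkovKernel κ]
    {ch : Choices D H c₄ c₅ η ε} {K₂ : ℝ} (hP : ∀ h ∈ ch.pack, Measurable h)
    (hν : 0 < noise₂ c₄ c₅ η ε) {τ : ℝ} (hντ : 4 * noise₂ c₄ c₅ η ε ≤ τ) (hK₂ : 18 ≤ K₂)
    (hδ : 0 < δ) (hδ1 : δ ≤ 1) {g : Hyp X} (hg : g ∈ ch.pack)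
    (herr : err (D ⊗ₘ κ) g ≤ 3 * η) {n : ℕ} {s : State X} (hs : s ∈ coveredStates ch g n) :
    (stage₂ ch (repetitions K₂ δ s.C.card) s.C.card s.C).FailsAtMost κ
      {h | h ∈ H ∧ err (D ⊗ₘ κ) h ≤ τ} (n * repetitions K₂ δ n)
      (δ - δ / ch.pack.card) := by
  obtain ⟨hs, hgS, hsn⟩ := hs
  have hCm : ∀ h ∈ s.C, Measurable h := fun h hh => hP h (hs.C_subset hh)
  have hfst : (D ⊗ₘ κ).fst = D := Measure.fst_compProd D κ
  obtain ⟨μ, hμ, hμg⟩ := hs.cover g hgS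
  have hμ_err : err (D ⊗ₘ κ) μ ≤ noise₂ c₄ c₅ η ε := by
    have := err_le_err_add_hdist hfst (hCm μ hμ) (hP g hg)
    rw [noise₂]
    linarith
  have hcard : 0 < s.C.card := Finset.card_pos.2 ⟨μ, hμ⟩
  have hgood : ∀ h ∈ s.C, hdist D h μ < 3 * noise₂ c₄ c₅ η ε →
      h ∈ {h | h ∈ H ∧ err (D ⊗ₘ κ) h ≤ τ} := fun h hh hhμ =>
    ⟨ch.pack_spec.1.1 h (hs.C_subset hh),
      by linarith [err_le_err_add_hdist hfst (hCm h hh) (hCm μ hμ)]⟩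
  refine (stage₂_failsAtMost ch hν hμ_err (repetitions K₂ δ s.C.card) hμ hCm hgood le_rfl).mono
    (Nat.mul_le_mul hsn (repetitions_mono (by linarith) hδ hcard hsn)) ?_
  have hpow := pow_repetitions_le (ρ := 17 / 18) (K := K₂) (a := 1) (by norm_num) (by norm_num)
    (by push_cast; linarith) hcard hδ hδ1
  have hk : (1 : ℝ) ≤ s.C.card := by exact_mod_cast hcard
  have hkN : (s.C.card : ℝ) ≤ ch.pack.card := by exact_mod_cast Finset.card_le_card hs.C_subset
  calc ((s.C.card : ℝ) - 1) * (17 / 18) ^ repetitions K₂ δ s.C.card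
      ≤ (s.C.card - 1) * (δ / s.C.card) ^ 1 :=
        mul_le_mul_of_nonneg_left hpow (by linarith)
    _ = δ - δ / s.C.card := by field_simp
    _ ≤ δ - δ / ch.pack.card := by gcongr

theorem Solves.mono {A : Prog X (Hyp X)} {m m' : ℕ} (hA : Solves D H η ε δ m A) (hm : m ≤ m') :
    Solves D H η ε δ m' A :=
  fun J κ hJ hκ hfst hJκ hopt => (hA J κ hJ hκ hfst hJκ hopt).trans (A.successProb_mono hm)

theorem solves_competitiveAlgorithm [IsProbabilityMeasure D] {η' K₁ K₂ v : ℝ}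
    (ch : Choices D H c₄ c₅ η' ε) (hH : ∀ h ∈ H, Measurable h)
    (hv : HasInformativeQueries D ch.pack (radius c₄ c₅ η' ε) (c₄ / 20 * η') v) (hv0 : 0 ≤ v)
    (hv6 : v ≤ 6) (hK₁ : 12 ≤ K₁ * v) (hK₂ : 18 ≤ K₂) (hη' : 0 ≤ η') (hηη' : η ≤ η')
    (hc₄ : 90 ≤ c₄) (hν : 0 < noise₂ c₄ c₅ η' ε) (hνε : 4 * noise₂ c₄ c₅ η' ε ≤ η + ε)
    (hδ : 0 < δ) (hδ1 : δ ≤ 1) {n : ℕ} (hn : n = repetitions K₁ δ ch.pack.card) :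
    Solves D H η ε δ (n + n * repetitions K₂ δ n) (competitiveAlgorithm ch K₁ K₂ δ) := by
  intro J κ _ _ _ hJκ hopt
  subst hJκ
  obtain ⟨h, hh, herr⟩ := hopt
  have hP : ∀ g ∈ ch.pack, Measurable g := fun g hg => hH g (ch.pack_spec.1.1 g hg)
  obtain ⟨g, hg, hg_err⟩ := ch.exists_err_le hH hη' ⟨h, hh, herr.trans hηη'⟩
  have hN : (1 : ℝ) ≤ ch.pack.card := by exact_mod_cast Finset.card_pos.2 ⟨g, hg⟩
  have stage_one := stage₁_failsAtMost_div (κ := κ) ch hP hv hv0 hv6 hK₁ hδ hδ1 hg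
    (by nlinarith) hn
  have stage_two := fun s hs =>
    stage₂_failsAtMost_sub_div (κ := κ) (s := s) (n := n) hP hν hνε hK₂ hδ hδ1 hg hg_err hs
  have hfails := stage_one.bind (by positivity) (sub_nonneg.2 (div_le_self hδ.le hN)) stage_two
  rw [add_sub_cancel, hn] at hfails
  rw [hn]
  exact hfails

theorem nonempty_choices_of_maximal [IsProbabilityMeasure D] {P : Finset (Hyp X)}
    (hP : Maximal (IsPacking D H (2 * η)) P) (hH : H.Nonempty) (hm : ∀ h ∈ H, Measurable h)
    (hc₄ : 0 ≤ c₄) (hη : 0 ≤ η) : Nonempty (Choices D H c₄ c₅ η ε) := by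
  have hPne : P.Nonempty := nonempty_of_maximal (by positivity) hP hH
  have hcenter : ∀ l, ∃ μ, IsHeaviestCenter D P l (radius c₄ c₅ η ε) μ := fun _ =>
    P.exists_max_image _ hPne
  have hquery : ∀ l, ∃ q, IsOptimalQuery D (uncertainty P l) (c₄ / 20 * η) q := fun l =>
    exists_isOptimalQuery (measurable_uncertainty (fun h hh => hm h (hP.1.1 h hh)) l)
      (finite_range_uncertainty P l) (by positivity)
  choose center center_spec using hcenter
  choose queryDist queryDist_spec using hquery
  let farPair (F : Finset (Hyp X)) (p : Hyp X × Hyp X) : Prop :=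
    p.1 ∈ F ∧ p.2 ∈ F ∧ 3 * noise₂ c₄ c₅ η ε ≤ hdist D p.1 p.2
  exact ⟨{
    pack := P
    pack_spec := hP
    center := center
    center_spec := center_spec
    queryDist := queryDist
    queryDist_spec := queryDist_spec
    pair := fun F => Classical.epsilon (farPair F)
    pair_spec := fun F ⟨h, hh, g, hg, hhg⟩ =>
      Classical.epsilon_spec (p := farPair F) ⟨(h, g), hh, hg, hhg⟩
    out := fun F => Classical.epsilon (· ∈ F)
    out_spec := fun F hF => Classical.epsilon_spec hF }⟩

end CompetitiveAlgorithm

/-! ### Number of queries -/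

section QueryBudget

theorem one_le_lg (t : ℝ) : 1 ≤ lg t := le_max_left _ _

theorem log_le_lg (t : ℝ) : Real.log t ≤ lg t := le_max_right _ _

theorem lg_le_lg {s t : ℝ} (hs : 0 < s) (hst : s ≤ t) : lg s ≤ lg t :=
  max_le_max le_rfl (Real.log_le_log hs hst)

theorem lg_mul_le {c t : ℝ} (hc : 1 ≤ c) (ht : 0 < t) :
    lg (c * t) ≤ (1 + Real.log c) * lg t := by
  have hlogc := Real.log_nonneg hc
  have hlgt := one_le_lg t
  refine max_le (by nlinarith) ?_
  rw [Real.log_mul (by positivity) ht.ne']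
  nlinarith [log_le_lg t]

theorem lg_sq_le (t : ℝ) : lg (t ^ 2) ≤ 2 * lg t :=
  max_le (by linarith [one_le_lg t]) (by rw [Real.log_pow]; push_cast; linarith [log_le_lg t])

theorem lg_one_div_mul_le {ε δ : ℝ} (hε : 0 < ε) (hδ : 0 < δ) (hδ1 : δ ≤ 1) :
    lg (1 / (ε * δ)) ≤ lg (1 / ε) / δ := by
  have hinv : 1 ≤ δ⁻¹ := (one_le_inv₀ hδ).2 hδ1
  calc lg (1 / (ε * δ)) = lg (δ⁻¹ * (1 / ε)) := by rw [one_div, one_div, mul_inv_rev]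
    _ ≤ (1 + Real.log δ⁻¹) * lg (1 / ε) := lg_mul_le hinv (by positivity)
    _ ≤ δ⁻¹ * lg (1 / ε) := by
        gcongr
        · exact zero_le_one.trans (one_le_lg _)
        · linarith [Real.log_le_sub_one_of_pos (inv_pos.2 hδ)]
    _ = lg (1 / ε) / δ := inv_mul_eq_div _ _

theorem repetitions_le {K δ : ℝ} (hK : 0 ≤ K) (N : ℕ) :
    repetitions K δ N ≤ (K + 1) * lg (N / δ) := by
  have hlg := one_le_lg (N / δ)
  have hlog : K * Real.log (N / δ) ≤ K * lg (N / δ) := by gcongr; exact log_le_lg _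
  rw [repetitions]
  calc (⌈K * Real.log (N / δ)⌉₊ : ℝ) ≤ ⌈K * lg (N / δ)⌉₊ := by exact_mod_cast Nat.ceil_mono hlog
    _ ≤ K * lg (N / δ) + 1 := (Nat.ceil_lt_add_one (by positivity)).le
    _ ≤ (K + 1) * lg (N / δ) := by linarith

theorem repetitions_le_lg_one_div {K c ε δ : ℝ} (hK : 0 ≤ K) (hc : 1 ≤ c) (hε : 0 < ε)
    (hδ : 0 < δ) {N : ℕ} (hN : 0 < N) (hNε : N ≤ c / ε) :
    repetitions K δ N ≤ (K + 1) * (1 + Real.log c) * lg (1 / (ε * δ)) := by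
  have : (0 : ℝ) < N := by exact_mod_cast hN
  calc (repetitions K δ N : ℝ) ≤ (K + 1) * lg (N / δ) := repetitions_le hK N
    _ ≤ (K + 1) * lg (c * (1 / (ε * δ))) := by
        gcongr
        refine lg_le_lg (by positivity) ?_
        rw [mul_one_div, ← div_div]
        gcongr
    _ ≤ (K + 1) * ((1 + Real.log c) * lg (1 / (ε * δ))) := by
        gcongr
        exact lg_mul_le hc (by positivity)
    _ = _ := by ring

theorem repetitions_le_lg_lg {K A ε δ : ℝ} (hK : 0 ≤ K) (hA : 1 ≤ A) (hε : 0 < ε) (hδ : 0 < δ)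
    (hδ1 : δ ≤ 1) {n : ℕ} (hn : 0 < n) (hnA : n ≤ A * lg (1 / (ε * δ))) :
    repetitions K δ n ≤ 2 * (K + 1) * (1 + Real.log A) * lg (lg (1 / ε) / δ) := by
  have : (0 : ℝ) < n := by exact_mod_cast hn
  have hl := one_le_lg (1 / ε)
  have hratio : n / δ ≤ A * (lg (1 / ε) / δ) ^ 2 :=
    calc n / δ ≤ A * (lg (1 / ε) / δ) / δ := by
          gcongr
          exact hnA.trans (by gcongr; exact lg_one_div_mul_le hε hδ hδ1)
      _ = A * (lg (1 / ε) / δ * (1 / δ)) := by ring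
      _ ≤ A * (lg (1 / ε) / δ * (lg (1 / ε) / δ)) := by gcongr
      _ = A * (lg (1 / ε) / δ) ^ 2 := by ring
  have hlogA := Real.log_nonneg hA
  calc (repetitions K δ n : ℝ) ≤ (K + 1) * lg (n / δ) := repetitions_le hK n
    _ ≤ (K + 1) * lg (A * (lg (1 / ε) / δ) ^ 2) := by
        gcongr
        exact lg_le_lg (by positivity) hratio
    _ ≤ (K + 1) * ((1 + Real.log A) * (2 * lg (lg (1 / ε) / δ))) := by
        gcongr
        exact (lg_mul_le hA (by positivity)).trans (by gcongr; exact lg_sq_le _)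
    _ = _ := by ring

theorem exists_queryBudget_le {K₁ K₂ c : ℝ} (hK₁ : 0 ≤ K₁) (hK₂ : 0 ≤ K₂) (hc : 1 ≤ c) :
    ∃ K : ℝ, 0 < K ∧ ∀ (N : ℕ) (ε δ : ℝ), 0 < ε → 0 < δ → δ ≤ 1 → N ≤ c / ε →
      (repetitions K₁ δ N + repetitions K₁ δ N * repetitions K₂ δ (repetitions K₁ δ N) : ℝ) ≤
        K * lg (1 / (ε * δ)) * lg (lg (1 / ε) / δ) := by
  have hlogc := Real.log_nonneg hc
  set A := (K₁ + 1) * (1 + Real.log c)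
  have hA : 1 ≤ A := by nlinarith
  have hlogA := Real.log_nonneg hA
  set B := 2 * (K₂ + 1) * (1 + Real.log A)
  have : 0 ≤ B := by positivity
  refine ⟨A * (1 + B), by positivity, fun N ε δ hε hδ hδ1 hNε => ?_⟩
  have hL := one_le_lg (1 / (ε * δ))
  have hl := one_le_lg (lg (1 / ε) / δ)
  obtain hn | hn := (repetitions K₁ δ N).eq_zero_or_pos
  · rw [hn, Nat.cast_zero, zero_mul, add_zero]
    positivity
  have hN : 0 < N := Nat.pos_of_ne_zero fun h => by simp [repetitions, h] at hn
  have hrounds : (repetitions K₁ δ N : ℝ) ≤ A * lg (1 / (ε * δ)) :=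
    repetitions_le_lg_one_div hK₁ hc hε hδ hN hNε
  have hcomparison := repetitions_le_lg_lg hK₂ hA hε hδ hδ1 hn hrounds
  set n := repetitions K₁ δ N
  calc (n + n * repetitions K₂ δ n : ℝ) = n * (1 + repetitions K₂ δ n) := by ring
    _ ≤ A * lg (1 / (ε * δ)) * (lg (lg (1 / ε) / δ) + B * lg (lg (1 / ε) / δ)) := by gcongr
    _ = A * (1 + B) * lg (1 / (ε * δ)) * lg (lg (1 / ε) / δ) := by ring

end QueryBudget

/-! ### Chains of hypotheses -/

section Thresholds

theorem isChain_thresholds (T : Set ℝ) : IsChain (· ≤ ·) (thresholds T) := by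
  rintro _ ⟨σ, -, rfl⟩ _ ⟨τ, -, rfl⟩ -
  refine (le_total τ σ).imp (fun h x => ?_) (fun h x => ?_) <;>
    simpa [Bool.le_iff_imp] using h.trans

theorem measurable_of_mem_thresholds {T : Set ℝ} {h : Hyp ℝ} (hh : h ∈ thresholds T) :
    Measurable h := by
  obtain ⟨τ, -, rfl⟩ := hh
  have hpre : (fun x : ℝ => decide (τ ≤ x)) ⁻¹' {true} = Set.Ici τ := by
    ext x
    simp
  exact measurable_to_bool (hpre ▸ measurableSet_Ici)

end Thresholds

section Chains

variable {X : Type} [MeasurableSpace X] {D : Measure X} [IsProbabilityMeasure D]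
  {H : Set (Hyp X)} {c₄ c₅ η η' ε δ : ℝ}

theorem nonempty_choices_of_isChain (hchain : IsChain (· ≤ ·) H) (hH : H.Nonempty)
    (hm : ∀ h ∈ H, Measurable h) (hc₄ : 0 ≤ c₄) (hη : 0 < η) :
    Nonempty (Choices D H c₄ c₅ η ε) := by
  obtain ⟨P, hP⟩ := exists_maximal_packing (D := D) fun P (hP : IsPacking D H (2 * η) P) =>
    Nat.le_floor (hP.card_le_of_isChain hchain hm (by positivity))
  exact nonempty_choices_of_maximal hP hH hm hc₄ hη.le

theorem solves_competitiveAlgorithm_of_isChain {K₁ K₂ : ℝ} (ch : Choices D H c₄ c₅ η' ε)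
    (hchain : IsChain (· ≤ ·) H) (hm : ∀ h ∈ H, Measurable h) (hK₁ : 240 ≤ K₁) (hK₂ : 18 ≤ K₂)
    (hc₄ : 90 ≤ c₄) (hc₅ : 0 ≤ c₅) (hη' : 0 < η') (hηη' : η ≤ η') (hε : 0 ≤ ε)
    (hν : 4 * noise₂ c₄ c₅ η' ε ≤ η + ε) (hδ : 0 < δ) (hδ1 : δ ≤ 1) :
    Solves D H η ε δ
      (repetitions K₁ δ ch.pack.card +
        repetitions K₁ δ ch.pack.card * repetitions K₂ δ (repetitions K₁ δ ch.pack.card))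
      (competitiveAlgorithm ch K₁ K₂ δ) := by
  have hpack := ch.pack_spec.1.1
  have hν0 : 0 < noise₂ c₄ c₅ η' ε := by rw [noise₂, radius]; positivity
  have hinf : HasInformativeQueries D ch.pack (radius c₄ c₅ η' ε) (c₄ / 20 * η') (1 / 20) :=
    hasInformativeQueries_of_isChain (hchain.mono hpack) (fun h hh => hm h (hpack h hh))
      (by positivity) (by rw [radius]; nlinarith)
  exact solves_competitiveAlgorithm ch hm hinf (by norm_num) (by norm_num) (by linarith) hK₂
    hη'.le hηη' hc₄ hν0 hν hδ hδ1 rfl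

end Chains

end

end ActiveLearning

open ActiveLearning in
theorem corollary1_general :
    ∃ c₁ c₄ c₅ K₁ K₂ K : ℝ,
      1 < c₁ ∧ 300 ≤ c₄ ∧ 0 < c₅ ∧ c₅ ≤ 1 / 10 ∧ 0 < K₁ ∧ 0 < K₂ ∧ 0 < K ∧
      ∀ (X : Type) [MeasurableSpace X] (D : Measure X), IsProbabilityMeasure D →
      ∀ H : Set (Hyp X), H.Nonempty → IsChain (· ≤ ·) H → (∀ h ∈ H, Measurable h) →
      ∀ η ε δ : ℝ, 0 ≤ η → 0 < ε → ε < 1 → 0 < δ → δ < 1 → c₁ * η < ε →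
        Nonempty (Choices D H c₄ c₅ (ε / c₁) ε) ∧
        ∀ ch : Choices D H c₄ c₅ (ε / c₁) ε,
          Solves D H η ε δ ⌊K * lg (1 / (ε * δ)) * lg (lg (1 / ε) / δ)⌋₊
            (competitiveAlgorithm ch K₁ K₂ δ) := by
  obtain ⟨K, hK, hbudget⟩ := exists_queryBudget_le (K₁ := 240) (K₂ := 18) (c := 10000)
    (by norm_num) (by norm_num) (by norm_num)
  refine ⟨10000, 300, 1 / 100, 240, 18, K, by norm_num, le_rfl, by norm_num, by norm_num,
    by norm_num, by norm_num, hK, fun X _ D _ H hH hchain hm η ε δ hη hε hε1 hδ hδ1 hηε =>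
      ⟨nonempty_choices_of_isChain hchain hH hm (by norm_num) (by positivity), fun ch => ?_⟩⟩
  have hcard : (ch.pack.card : ℝ) ≤ 10000 / ε :=
    calc (ch.pack.card : ℝ) ≤ 1 + 1 / (2 * (ε / 10000)) :=
          ch.pack_spec.1.card_le_of_isChain hchain hm (by positivity)
      _ = (ε + 5000) / ε := by field_simp; ring
      _ ≤ 10000 / ε := by gcongr; linarith
  refine (solves_competitiveAlgorithm_of_isChain ch hchain hm le_rfl le_rfl (by norm_num)
    (by norm_num) (by positivity) (by linarith) hε.le (by rw [noise₂, radius]; linarith) hδ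
    hδ1.le).mono (Nat.le_floor ?_)
  exact_mod_cast hbudget _ ε δ hε hδ hδ1.le hcard

theorem corollary1 :
    ∃ c₁ c₄ c₅ K₁ K₂ K : ℝ,
      1 < c₁ ∧ 300 ≤ c₄ ∧ 0 < c₅ ∧ c₅ ≤ 1 / 10 ∧ 0 < K₁ ∧ 0 < K₂ ∧ 0 < K ∧
      ∀ (D : MeasureTheory.Measure ℝ), MeasureTheory.IsProbabilityMeasure D →
      ∀ (T : Set ℝ), T.Nonempty →
      ∀ (η ε δ : ℝ), 0 ≤ η → 0 < ε → ε < 1 → 0 < δ → δ < 1 → c₁ * η < ε →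
        Nonempty (ActiveLearning.Choices D (ActiveLearning.thresholds T) c₄ c₅ (ε / c₁) ε) ∧
        ∀ ch : ActiveLearning.Choices D (ActiveLearning.thresholds T) c₄ c₅ (ε / c₁) ε,
          ActiveLearning.Solves D (ActiveLearning.thresholds T) η ε δ
            ⌊K * ActiveLearning.lg (1 / (ε * δ)) *
              ActiveLearning.lg (ActiveLearning.lg (1 / ε) / δ)⌋₊
            (ActiveLearning.competitiveAlgorithm ch K₁ K₂ δ) := by
  obtain ⟨c₁, c₄, c₅, K₁, K₂, K, hc₁, hc₄, hc₅, hc₅', hK₁, hK₂, hK, h⟩ := corollary1_general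
  exact ⟨c₁, c₄, c₅, K₁, K₂, K, hc₁, hc₄, hc₅, hc₅', hK₁, hK₂, hK, fun D hD T hT =>
    h ℝ D hD _ (hT.image _) (ActiveLearning.isChain_thresholds T) fun _ =>
      ActiveLearning.measurable_of_mem_thresholds⟩
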